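/- Let $k$ be a field, let $G$ be a finite group whose order is invertible in $k$, and let $\Lambda$ be an associative unital $k$-algebra on which $G$ acts by $k$-algebra automorphisms. For a $k$-algebra $A$ let $C^n(A)=\mathrm{Hom}_k(A^{\otimes n},A)$, $n\ge 0$, be the Hochschild cochain complex with the Hochschild coboundary, and let $HH^*(A)=\bigoplus_{n\ge 0}HH^n(A)$ be its cohomology, a graded $k$-algebra under the cup product $$(\psi\smile\varphi)(a_1\otimes\cdots\otimes a_{m+n})=\psi(a_1\otimes\cdots\otimes a_m)\,\varphi(a_{m+1}\otimes\cdots\otimes a_{m+n}).$$ The group $G$ acts on $HH^*(\Lambda)$ by algebra automorphisms, via $(s\cdot\varphi)(a_1\otimes\cdots\otimes a_n)=s\big(\varphi(s^{-1}a_1\otimes\cdots\otimes s^{-1}a_n)\big)$ on cochains; let $HH^*(\Lambda)^G$ be the subalgebra of invariants. Let $\Lambda[G]=\Lambda\otimes kG$ be the skew group algebra, with product $(a\otimes s)(b\otimes t)=a\,s(b)\otimes st$, graded by $G$ with $\Lambda[G]^s=\Lambda\otimes s$. Let $C^n_{\{1\}}(\Lambda[G])\subseteq C^n(\Lambda[G])$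 be the space of cochains $\varphi$ such that $\varphi\big(\Lambda[G]^{s_1}\otimes\cdots\otimes\Lambda[G]^{s_n}\big)\subseteq\Lambda[G]^{s_1\cdots s_n}$ for all $s_1,\dots,s_n\in G$ (the cochains of the trivial conjugacy class). These form a differential graded subalgebra of $C^\bullet(\Lambda[G])$; let $HH^*_{\{1\}}(\Lambda[G])$ be its cohomology algebra. Theorem. There is an isomorphism of graded $k$-algebras $$HH^*_{\{1\}}(\Lambda[G])\;\simeq\; HH^*(\Lambda)^G .$$ -/

import Mathlib

open scoped DirectSum

noncomputable section

/-! ### Hochschild cochains of an algebra, their differential and their cup product -/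

/-- The space `C^n(A) = Hom_k(A^{⊗ n}, A)` of Hochschild cochains of degree `n`. -/
abbrev HochschildCochain (k : Type*) (A : Type*) [Field k] [Ring A] [Algebra k A] (n : ℕ) :=
  MultilinearMap k (fun _ : Fin n => A) A

namespace HochschildCochain

variable {k : Type*} {A : Type*} [Field k] [Ring A] [Algebra k A]

/-- The usual additive group structure, arranged so that instance search sees that it extends the
usual additive monoid structure. -/
instance instAddCommGroup (n : ℕ) : AddCommGroup (HochschildCochain k A n) :=
  { (MultilinearMap.addCommMonoid : AddCommMonoid (HochschildCochain k A n)),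
    (MultilinearMap.instAddCommGroup : AddCommGroup (HochschildCochain k A n)) with }

/-- Evaluation of a cochain on the first entries of a sequence (only used in proofs). -/
def ev {n : ℕ} (φ : HochschildCochain k A n) (a : ℕ → A) : A := φ (fun i => a i)

theorem ext_ev {n : ℕ} {φ ψ : HochschildCochain k A n} (h : ∀ a, φ.ev a = ψ.ev a) : φ = ψ := by
  ext a
  have := h (fun i => if hi : i < n then a ⟨i, hi⟩ else 0)
  simpa [ev] using this

theorem mk_ext {n m : ℕ} {φ : HochschildCochain k A n} {ψ : HochschildCochain k A m}
    (hnm : n = m) (h : ∀ a, φ.ev a = ψ.ev a) :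
    (GradedMonoid.mk n φ : GradedMonoid (HochschildCochain k A)) = GradedMonoid.mk m ψ := by
  subst hnm
  rw [ext_ev h]

/-- The unit: the element `1` of `C^0(A) = A`. -/
def one (k : Type*) (A : Type*) [Field k] [Ring A] [Algebra k A] : HochschildCochain k A 0 :=
  MultilinearMap.constOfIsEmpty k _ 1

theorem ev_one (a : ℕ → A) : (one k A).ev a = 1 := rfl

/-- The cup product `(ψ ⌣ φ)(a₁, …, a_{m+n}) = ψ(a₁, …, a_m) φ(a_{m+1}, …, a_{m+n})`. -/
def cup {m n : ℕ} (ψ : HochschildCochain k A m) (φ : HochschildCochain k A n) :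
    HochschildCochain k A (m + n) :=
  (LinearMap.mul' k A).compMultilinearMap ((ψ.domCoprod φ).domDomCongr finSumFinEquiv)

theorem cup_apply {m n : ℕ} (ψ : HochschildCochain k A m) (φ : HochschildCochain k A n)
    (a : Fin (m + n) → A) :
    cup ψ φ a = ψ (fun i => a (Fin.castAdd n i)) * φ (fun j => a (Fin.natAdd m j)) := rfl

theorem ev_cup {m n : ℕ} (ψ : HochschildCochain k A m) (φ : HochschildCochain k A n)
    (a : ℕ → A) : (cup ψ φ).ev a = ψ.ev a * φ.ev (fun i => a (m + i)) := rfl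

theorem contractNth_update {n : ℕ} (i : Fin n) (a : Fin (n + 1) → A) (j : Fin (n + 1)) :
    ∃ (j' : Fin n) (f : A →ₗ[k] A), ∀ x : A,
      Fin.contractNth i.castSucc (· * ·) (Function.update a j x) =
        Function.update (Fin.contractNth i.castSucc (· * ·) a) j' (f x) := by
  rcases lt_trichotomy (j : ℕ) i with h | h | h
  · refine ⟨⟨j, by omega⟩, LinearMap.id, fun x => ?_⟩
    funext l
    simp only [Fin.contractNth, Function.update_apply, Fin.ext_iff, Fin.val_castSucc,
      Fin.val_succ, LinearMap.id_apply]
    split_ifs <;> first | rfl | omega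
  · refine ⟨i, LinearMap.mulRight k (a i.succ), fun x => ?_⟩
    funext l
    by_cases hl : l = i
    · subst hl
      simp [Fin.contractNth, Function.update_apply, Fin.ext_iff, h]
    · have hl' : (l : ℕ) ≠ i := fun h => hl (Fin.ext h)
      simp only [Fin.contractNth, Function.update_apply, Fin.ext_iff, Fin.val_castSucc,
        Fin.val_succ, h]
      split_ifs <;> first | rfl | omega
  · by_cases h' : (j : ℕ) = i + 1
    · refine ⟨i, LinearMap.mulLeft k (a i.castSucc), fun x => ?_⟩
      funext l
      by_cases hl : l = i
      · subst hl
        simp [Fin.contractNth, Function.update_apply, Fin.ext_iff, h']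
      · have hl' : (l : ℕ) ≠ i := fun h => hl (Fin.ext h)
        simp only [Fin.contractNth, Function.update_apply, Fin.ext_iff, Fin.val_castSucc,
          Fin.val_succ, h']
        split_ifs <;> first | rfl | omega
    · refine ⟨⟨j - 1, by omega⟩, LinearMap.id, fun x => ?_⟩
      funext l
      simp only [Fin.contractNth, Function.update_apply, Fin.ext_iff, Fin.val_castSucc,
        Fin.val_succ, LinearMap.id_apply]
      split_ifs <;> first | rfl | omega

/-- `(a₀, …, a_n) ↦ a₀ φ(a₁, …, a_n)`. -/
def faceFirst {n : ℕ} (φ : HochschildCochain k A n) : HochschildCochain k A (n + 1) :=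
  LinearMap.uncurryLeft
    (({ toFun := fun x => (LinearMap.mulLeft k x).compMultilinearMap φ
        map_add' := fun x y => by ext; simp [add_mul]
        map_smul' := fun c x => by ext; simp }) :
      A →ₗ[k] MultilinearMap k (fun _ : Fin n => A) A)

theorem faceFirst_apply {n : ℕ} (φ : HochschildCochain k A n) (a : Fin (n + 1) → A) :
    faceFirst φ a = a 0 * φ (fun i => a i.succ) := rfl

/-- `(a₀, …, a_n) ↦ φ(a₀, …, a_i a_{i+1}, …, a_n)`. -/
def faceMid {n : ℕ} (i : Fin n) (φ : HochschildCochain k A n) : HochschildCochain k A (n + 1) where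
  toFun a := φ (Fin.contractNth i.castSucc (· * ·) a)
  map_update_add' {inst} a j x y := by
    rw [Subsingleton.elim inst (instDecidableEqFin _)]
    obtain ⟨j', f, h⟩ := contractNth_update (k := k) i a j
    simp only [h, map_add, MultilinearMap.map_update_add]
  map_update_smul' {inst} a j c x := by
    rw [Subsingleton.elim inst (instDecidableEqFin _)]
    obtain ⟨j', f, h⟩ := contractNth_update (k := k) i a j
    simp only [h, map_smul, MultilinearMap.map_update_smul]

theorem faceMid_apply {n : ℕ} (i : Fin n) (φ : HochschildCochain k A n) (a : Fin (n + 1) → A) :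
    faceMid i φ a = φ (Fin.contractNth i.castSucc (· * ·) a) := rfl

/-- `(a₀, …, a_n) ↦ φ(a₀, …, a_{n-1}) a_n`. -/
def faceLast {n : ℕ} (φ : HochschildCochain k A n) : HochschildCochain k A (n + 1) :=
  MultilinearMap.uncurryRight
    ((LinearMap.mul k A).compMultilinearMap φ)

theorem faceLast_apply {n : ℕ} (φ : HochschildCochain k A n) (a : Fin (n + 1) → A) :
    faceLast φ a = φ (fun i => a i.castSucc) * a (Fin.last n) := rfl

/-- The Hochschild coboundary `C^n(A) → C^{n+1}(A)`. -/
def d (n : ℕ) : HochschildCochain k A n →ₗ[k] HochschildCochain k A (n + 1) where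
  toFun φ := faceFirst φ + ∑ i : Fin n, (-1 : k) ^ ((i : ℕ) + 1) • faceMid i φ
    + (-1 : k) ^ (n + 1) • faceLast φ
  map_add' φ ψ := by
    ext a
    simp only [add_apply, sum_apply, smul_apply,
      faceFirst_apply, faceMid_apply, faceLast_apply, mul_add, add_mul, smul_add,
      Finset.sum_add_distrib]
    abel
  map_smul' c φ := by
    ext a
    simp only [add_apply, sum_apply, smul_apply,
      faceFirst_apply, faceMid_apply, faceLast_apply, smul_add, Finset.smul_sum,
      mul_smul_comm, smul_mul_assoc, RingHom.id_apply, smul_comm c]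

theorem d_apply {n : ℕ} (φ : HochschildCochain k A n) (a : Fin (n + 1) → A) :
    d n φ a = a 0 * φ (fun i => a i.succ)
      + ∑ i : Fin n, (-1 : k) ^ ((i : ℕ) + 1) • φ (Fin.contractNth i.castSucc (· * ·) a)
      + (-1 : k) ^ (n + 1) • (φ (fun i => a i.castSucc) * a (Fin.last n)) := by
  simp only [d, LinearMap.coe_mk, AddHom.coe_mk, add_apply,
    sum_apply, smul_apply, faceFirst_apply, faceMid_apply,
    faceLast_apply]

/-- Multiplying the entries `i` and `i + 1` of a sequence (only used in proofs). -/
def contr (i : ℕ) (a : ℕ → A) (l : ℕ) : A :=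
  if l < i then a l else if l = i then a l * a (l + 1) else a (l + 1)

theorem ev_d {n : ℕ} (φ : HochschildCochain k A n) (a : ℕ → A) :
    (d n φ).ev a = a 0 * φ.ev (fun i => a (i + 1))
      + ∑ i ∈ Finset.range n, (-1 : k) ^ (i + 1) • φ.ev (contr i a)
      + (-1 : k) ^ (n + 1) • (φ.ev a * a n) := by
  rw [Finset.sum_range]
  exact d_apply φ _

theorem contr_contr {i j : ℕ} (h : i ≤ j) (a : ℕ → A) :
    contr j (contr i a) = contr i (contr (j + 1) a) := by
  funext l
  simp only [contr]
  split_ifs <;> first | rfl | omega | simp only [mul_assoc]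

theorem sum_contr_contr (F : (ℕ → A) → A) (a : ℕ → A) (n : ℕ) :
    ∑ i ∈ Finset.range (n + 1), ∑ j ∈ Finset.range n,
      (-1 : k) ^ (i + j) • F (contr j (contr i a)) = 0 := by
  rw [← Finset.sum_product']
  refine Finset.sum_involution
    (fun p _ => if p.1 ≤ p.2 then (p.2 + 1, p.1) else (p.2, p.1 - 1)) ?_ ?_ ?_ ?_
  · rintro ⟨i, j⟩ _
    by_cases h : i ≤ j
    · simp only [h, if_true]
      rw [← contr_contr h]
      module
    · simp only [h, if_false]
      obtain ⟨i, rfl⟩ : ∃ i', i = i' + 1 := ⟨i - 1, by omega⟩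
      rw [Nat.add_sub_cancel, contr_contr (by omega : j ≤ i)]
      module
  · rintro ⟨i, j⟩ _ _ h
    split_ifs at h <;> simp only [Prod.mk.injEq] at h <;> omega
  · rintro ⟨i, j⟩ h
    simp only [Finset.mem_product, Finset.mem_range] at h ⊢
    split_ifs <;> dsimp only <;> omega
  · rintro ⟨i, j⟩ _
    by_cases h : i ≤ j
    · simp [h]
    · simp only [h, if_false, (by omega : j ≤ i - 1), if_true, Prod.mk.injEq, and_true]
      omega

theorem d_d {n : ℕ} (φ : HochschildCochain k A n) : d (n + 1) (d n φ) = 0 := by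
  apply ext_ev
  intro a
  have h0 : (0 : HochschildCochain k A (n + 1 + 1)).ev a = 0 := rfl
  have key := sum_contr_contr (k := k) (fun b => φ.ev b) a n
  have c0 : (fun i => contr 0 a (i + 1)) = fun i => a (i + 1 + 1) := by
    funext i; simp [contr]
  have cs : ∀ i, (fun l => contr (i + 1) a (l + 1)) = contr i (fun l => a (l + 1)) := by
    intro i; funext l; simp [contr]
  have cl : φ.ev (contr n a) = φ.ev a := by
    simp only [ev]; congr 1; funext i; rw [contr, if_pos i.2]
  have h1 : ∀ i ∈ Finset.range n, (contr i a) n = a (n + 1) := by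
    intro i hi
    rw [Finset.mem_range] at hi
    rw [contr, if_neg (by omega), if_neg (by omega)]
  have cn : contr n a n = a n * a (n + 1) := by simp [contr]
  have c00 : contr 0 a 0 = a 0 * a 1 := by simp [contr]
  have cs0 : ∀ i, contr (i + 1) a 0 = a 0 := by intro i; simp [contr]
  have hA : ∑ i ∈ Finset.range (n + 1), (-1 : k) ^ (i + 1) •
      (contr i a 0 * φ.ev (fun l => contr i a (l + 1))) =
      -(a 0 * a 1 * φ.ev (fun i => a (i + 1 + 1))) - a 0 * ∑ i ∈ Finset.range n,
        (-1 : k) ^ (i + 1) • φ.ev (contr i (fun l => a (l + 1))) := by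
    rw [Finset.sum_range_succ', Finset.mul_sum, c0, c00]
    simp only [cs, cs0, mul_smul_comm, pow_succ, mul_neg, mul_one, neg_smul, neg_neg,
      Finset.sum_neg_distrib, pow_zero, one_smul]
    abel
  have hC : ∑ i ∈ Finset.range (n + 1), (-1 : k) ^ (i + 1) •
      ((-1 : k) ^ (n + 1) • (φ.ev (contr i a) * contr i a n)) =
      (-1 : k) ^ (n + 1) • ((∑ i ∈ Finset.range n, (-1 : k) ^ (i + 1) • φ.ev (contr i a))
        * a (n + 1)) + φ.ev a * (a n * a (n + 1)) := by
    rw [Finset.sum_range_succ, cl, cn, Finset.sum_mul, Finset.smul_sum]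
    congr 1
    · refine Finset.sum_congr rfl fun i hi => ?_
      rw [h1 i hi, smul_mul_assoc, smul_comm]
    · rw [smul_smul, ← pow_add, Even.neg_one_pow ⟨n + 1, rfl⟩, one_smul]
  have hB : ∑ i ∈ Finset.range (n + 1), (-1 : k) ^ (i + 1) •
      ∑ j ∈ Finset.range n, (-1 : k) ^ (j + 1) • φ.ev (contr j (contr i a)) = 0 := by
    rw [← key]
    refine Finset.sum_congr rfl fun i _ => ?_
    rw [Finset.smul_sum]
    refine Finset.sum_congr rfl fun j _ => ?_
    module
  rw [h0, ev_d, ev_d, ev_d]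
  simp only [ev_d, smul_add, Finset.sum_add_distrib]
  rw [hA, hB, hC]
  generalize (∑ i ∈ Finset.range n, (-1 : k) ^ (i + 1) • φ.ev (contr i a)) = P
  generalize (∑ i ∈ Finset.range n,
    (-1 : k) ^ (i + 1) • φ.ev (contr i (fun j => a (j + 1)))) = Q
  have h2 : (-1 : k) ^ (n + 1 + 1) * (-1 : k) ^ (n + 1) = -1 := by
    rw [← pow_add]; exact Odd.neg_one_pow ⟨n + 1, by ring⟩
  simp only [add_mul, mul_add, smul_add, smul_mul_assoc, mul_smul_comm, smul_smul, mul_assoc, h2,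
    zero_add]
  module

/-- The graded Leibniz rule. -/
theorem ev_d_cup {m n : ℕ} (ψ : HochschildCochain k A m) (φ : HochschildCochain k A n)
    (a : ℕ → A) :
    (d (m + n) (cup ψ φ)).ev a =
      (cup (d m ψ) φ).ev a + (-1 : k) ^ m • (cup ψ (d n φ)).ev a := by
  have h1 : ∀ i ∈ Finset.range m, (-1 : k) ^ (i + 1) • (cup ψ φ).ev (contr i a) =
      (-1 : k) ^ (i + 1) • (ψ.ev (contr i a)) * φ.ev (fun j => a (m + 1 + j)) := by
    intro i hi
    rw [Finset.mem_range] at hi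
    rw [ev_cup, smul_mul_assoc]
    congr 3
    funext j
    rw [contr, if_neg (by omega), if_neg (by omega)]
    congr 1; omega
  have h2 : ∀ i ∈ Finset.range n, (-1 : k) ^ (m + i + 1) • (cup ψ φ).ev (contr (m + i) a) =
      (-1 : k) ^ m • (ψ.ev a * ((-1 : k) ^ (i + 1) • φ.ev (contr i (fun j => a (m + j))))) := by
    intro i _
    rw [ev_cup, mul_smul_comm, smul_smul, add_assoc, pow_add]
    congr 2
    · simp only [ev]
      congr 1
      funext j
      rw [contr, if_pos (by omega)]
    · congr 1
      funext j
      simp only [contr, add_lt_add_iff_left, add_right_inj, add_assoc]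
  rw [ev_d, Finset.sum_range_add, Finset.sum_congr rfl h1, Finset.sum_congr rfl h2,
    ← Finset.sum_mul, ← Finset.smul_sum, ← Finset.mul_sum]
  simp only [ev_cup, ev_d, add_zero]
  have e1 : (fun i => a (m + (i + 1))) = fun i => a (m + 1 + i) := by
    funext i; congr 1; omega
  have e2 : (fun i => a (m + i + 1)) = fun i => a (m + 1 + i) := by
    funext i; congr 1; omega
  simp only [e1, e2]
  generalize (∑ i ∈ Finset.range m, (-1 : k) ^ (i + 1) • ψ.ev (contr i a)) = P
  generalize (∑ i ∈ Finset.range n,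
    (-1 : k) ^ (i + 1) • φ.ev (contr i (fun j => a (m + j)))) = Q
  simp only [add_mul, mul_add, smul_add, smul_mul_assoc, mul_smul_comm, smul_smul, mul_assoc]
  module

theorem d_cup_eq_zero {m n : ℕ} {ψ : HochschildCochain k A m} {φ : HochschildCochain k A n}
    (hψ : d m ψ = 0) (hφ : d n φ = 0) : d (m + n) (cup ψ φ) = 0 := by
  apply ext_ev
  intro a
  rw [ev_d_cup, hψ, hφ, ev_cup, ev_cup]
  simp [ev]

theorem d_one : d 0 (one k A) = 0 := by
  apply ext_ev
  intro a
  rw [ev_d, ev_one, ev_one]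
  simp [ev]

/-- Transport of cochains along an algebra automorphism `σ`:
`(σ·φ)(a₁, …, a_n) = σ(φ(σ⁻¹ a₁, …, σ⁻¹ a_n))`. -/
def conj (σ : A ≃ₐ[k] A) (n : ℕ) : HochschildCochain k A n →ₗ[k] HochschildCochain k A n where
  toFun φ := σ.toLinearMap.compMultilinearMap
    (φ.compLinearMap (fun _ => σ.symm.toLinearMap))
  map_add' φ ψ := by ext a; simp
  map_smul' c φ := by ext a; simp

theorem conj_apply (σ : A ≃ₐ[k] A) {n : ℕ} (φ : HochschildCochain k A n) (a : Fin n → A) :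
    conj σ n φ a = σ (φ (fun i => σ.symm (a i))) := rfl

theorem conj_one (σ : A ≃ₐ[k] A) : conj σ 0 (one k A) = one k A := by
  ext a
  exact map_one σ

theorem conj_cup (σ : A ≃ₐ[k] A) {m n : ℕ} (ψ : HochschildCochain k A m)
    (φ : HochschildCochain k A n) :
    conj σ (m + n) (cup ψ φ) = cup (conj σ m ψ) (conj σ n φ) := by
  ext a
  simp only [conj_apply, cup_apply, map_mul]

theorem conj_d (σ : A ≃ₐ[k] A) {n : ℕ} (φ : HochschildCochain k A n) :
    conj σ (n + 1) (d n φ) = d n (conj σ n φ) := by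
  ext a
  have h : ∀ i : Fin n, (fun l => σ.symm (Fin.contractNth i.castSucc (· * ·) a l)) =
      Fin.contractNth i.castSucc (· * ·) (fun l => σ.symm (a l)) := by
    intro i
    funext l
    simp only [Fin.contractNth]
    split_ifs <;> simp only [map_mul]
  simp only [conj_apply, d_apply, map_add, map_sum, map_smul, map_mul, h,
    AlgEquiv.apply_symm_apply]

theorem conj_refl (n : ℕ) (φ : HochschildCochain k A n) :
    conj (1 : A ≃ₐ[k] A) n φ = φ := rfl

theorem conj_mul (σ τ : A ≃ₐ[k] A) (n : ℕ) (φ : HochschildCochain k A n) :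
    conj (σ * τ) n φ = conj σ n (conj τ n φ) := rfl

end HochschildCochain

open HochschildCochain

/-! ### Cohomology algebras of differential graded subalgebras of the cochain algebra -/

/-- A differential graded subalgebra of the Hochschild cochain algebra `C^•(A)`. -/
structure HochschildDGSubalgebra (k : Type*) (A : Type*) [Field k] [Ring A] [Algebra k A] where
  carrier : ∀ n : ℕ, Submodule k (HochschildCochain k A n)
  one_mem : one k A ∈ carrier 0
  cup_mem : ∀ {m n : ℕ} {ψ : HochschildCochain k A m} {φ : HochschildCochain k A n},
    ψ ∈ carrier m → φ ∈ carrier n → cup ψ φ ∈ carrier (m + n)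
  d_mem : ∀ {n : ℕ} {φ : HochschildCochain k A n}, φ ∈ carrier n → d n φ ∈ carrier (n + 1)

namespace HochschildDGSubalgebra

variable {k : Type*} {A : Type*} [Field k] [Ring A] [Algebra k A]
variable (S : HochschildDGSubalgebra k A)

/-- The cocycles of degree `n` of `S`. -/
def cocycles (n : ℕ) : Submodule k (HochschildCochain k A n) :=
  S.carrier n ⊓ LinearMap.ker (d n)

/-- The coboundaries of degree `n` of `S`: the images of the cochains of `S` of degree `n - 1`,
and zero if `n = 0`. -/
def coboundaries : ∀ n : ℕ, Submodule k (HochschildCochain k A n)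
  | 0 => ⊥
  | n + 1 => (S.carrier n).map (d n)

theorem coboundaries_le_cocycles (n : ℕ) : S.coboundaries n ≤ S.cocycles n := by
  cases n with
  | zero => exact bot_le
  | succ n =>
    rintro _ ⟨c, hc, rfl⟩
    exact ⟨S.d_mem hc, d_d c⟩

/-- The `n`-th cohomology space `H^n(S)`: cocycles modulo coboundaries. -/
def Cohomology (n : ℕ) : Type _ :=
  S.cocycles n ⧸ (S.coboundaries n).submoduleOf (S.cocycles n)

instance (n : ℕ) : AddCommGroup (S.Cohomology n) :=
  inferInstanceAs (AddCommGroup (S.cocycles n ⧸ (S.coboundaries n).submoduleOf (S.cocycles n)))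

instance (n : ℕ) : Module k (S.Cohomology n) :=
  inferInstanceAs (Module k (S.cocycles n ⧸ (S.coboundaries n).submoduleOf (S.cocycles n)))

/-- The class of a cocycle. -/
def cls (n : ℕ) : S.cocycles n →ₗ[k] S.Cohomology n :=
  Submodule.mkQ ((S.coboundaries n).submoduleOf (S.cocycles n))

theorem cls_surjective (n : ℕ) : Function.Surjective (S.cls n) := Submodule.mkQ_surjective _

theorem cls_eq_iff {n : ℕ} {x y : S.cocycles n} :
    S.cls n x = S.cls n y ↔ x.1 - y.1 ∈ S.coboundaries n :=
  Submodule.Quotient.eq _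

/-- The unit cocycle. -/
def oneCocycle : S.cocycles 0 := ⟨one k A, S.one_mem, d_one⟩

/-- The cup product of two cocycles. -/
def cupCocycle {m n : ℕ} (x : S.cocycles m) (y : S.cocycles n) : S.cocycles (m + n) :=
  ⟨cup x.1 y.1, S.cup_mem x.2.1 y.2.1, d_cup_eq_zero x.2.2 y.2.2⟩

theorem cup_coboundary_right {m n : ℕ} {x : HochschildCochain k A m} (hx : x ∈ S.cocycles m)
    {b : HochschildCochain k A n} (hb : b ∈ S.coboundaries n) :
    cup x b ∈ S.coboundaries (m + n) := by
  cases n with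
  | zero =>
    rw [(Submodule.mem_bot k).1 hb]
    have h : cup x (0 : HochschildCochain k A 0) = 0 := by
      ext a; exact mul_zero _
    rw [h]
    exact Submodule.zero_mem _
  | succ n =>
    obtain ⟨c, hc, rfl⟩ := hb
    refine ⟨(-1 : k) ^ m • cup x c, Submodule.smul_mem _ _ (S.cup_mem hx.1 hc), ?_⟩
    apply ext_ev
    intro a
    have h := ev_d_cup x c a
    rw [show d m x = 0 from hx.2] at h
    have h' : ((d (m + n)) ((-1 : k) ^ m • cup x c)).ev a =
        (-1 : k) ^ m • ((d (m + n)) (cup x c)).ev a := by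
      rw [map_smul]; rfl
    refine h'.trans ?_
    rw [h, ev_cup]
    simp only [ev, zero_apply, zero_mul, zero_add, smul_smul, ← pow_add,
      Even.neg_one_pow ⟨m, rfl⟩, one_smul]
    rfl

theorem cup_coboundary_left {m n : ℕ} {b : HochschildCochain k A m} (hb : b ∈ S.coboundaries m)
    {y : HochschildCochain k A n} (hy : y ∈ S.cocycles n) :
    cup b y ∈ S.coboundaries (m + n) := by
  cases m with
  | zero =>
    rw [(Submodule.mem_bot k).1 hb]
    have h : cup (0 : HochschildCochain k A 0) y = 0 := by
      ext a; exact zero_mul _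
    rw [h]
    exact Submodule.zero_mem _
  | succ m =>
    obtain ⟨c, hc, rfl⟩ := hb
    have key : ∀ N (hN : N = m + n + 1) (z : HochschildCochain k A N),
        (∀ a, z.ev a = (d (m + n) (cup c y)).ev a) → z ∈ S.coboundaries N := by
      rintro N rfl z hz
      rw [ext_ev hz]
      exact ⟨cup c y, S.cup_mem hc hy.1, rfl⟩
    refine key _ (by omega) _ fun a => ?_
    rw [ev_d_cup, show d n y = 0 from hy.2, ev_cup c 0]
    simp [ev]

/-- The cup product on cohomology, induced by the cup product of cocycles. -/
def cohomologyCup {m n : ℕ} : S.Cohomology m → S.Cohomology n → S.Cohomology (m + n) :=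
  Quotient.map₂ S.cupCocycle <| by
    intro x x' hx y y' hy
    rw [← Quotient.eq_iff_equiv] at hx hy ⊢
    have hx' := S.cls_eq_iff.1 hx
    have hy' := S.cls_eq_iff.1 hy
    refine S.cls_eq_iff.2 ?_
    have : (S.cupCocycle x y).1 - (S.cupCocycle x' y').1 = cup (x.1 - x'.1) y.1 +
          cup x'.1 (y.1 - y'.1) := by
      ext a
      simp only [cupCocycle, sub_apply, add_apply, cup_apply, sub_mul, mul_sub]
      abel
    rw [this]
    exact Submodule.add_mem _ (S.cup_coboundary_left hx' y.2) (S.cup_coboundary_right x'.2 hy')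

theorem cohomologyCup_cls {m n : ℕ} (x : S.cocycles m) (y : S.cocycles n) :
    S.cohomologyCup (S.cls m x) (S.cls n y) = S.cls (m + n) (S.cupCocycle x y) := rfl

theorem gradedMk_eq {m n : ℕ} {x : S.cocycles m} {y : S.cocycles n} (hmn : m = n)
    (h : ∀ a, x.1.ev a = y.1.ev a) :
    (GradedMonoid.mk m (S.cls m x) : GradedMonoid S.Cohomology) =
      GradedMonoid.mk n (S.cls n y) := by
  subst hmn
  rw [Subtype.ext (ext_ev h)]

instance : GradedMonoid.GMul S.Cohomology := ⟨S.cohomologyCup⟩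

instance : GradedMonoid.GOne S.Cohomology := ⟨S.cls 0 S.oneCocycle⟩

instance instGRing : DirectSum.GRing S.Cohomology where
  mul_zero {m n} x := by
    obtain ⟨x, rfl⟩ := S.cls_surjective _ x
    refine (congrArg (S.cls (m + n)) (?_ : S.cupCocycle x 0 = 0)).trans (map_zero _)
    apply Subtype.ext; ext a; exact mul_zero _
  zero_mul {m n} y := by
    obtain ⟨y, rfl⟩ := S.cls_surjective _ y
    refine (congrArg (S.cls (m + n)) (?_ : S.cupCocycle 0 y = 0)).trans (map_zero _)
    apply Subtype.ext; ext a; exact zero_mul _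
  mul_add {m n} x y z := by
    obtain ⟨x, rfl⟩ := S.cls_surjective _ x
    obtain ⟨y, rfl⟩ := S.cls_surjective _ y
    obtain ⟨z, rfl⟩ := S.cls_surjective _ z
    refine congrArg (S.cls (m + n))
      (?_ : S.cupCocycle x (y + z) = S.cupCocycle x y + S.cupCocycle x z)
    apply Subtype.ext; ext a; exact mul_add _ _ _
  add_mul {m n} x y z := by
    obtain ⟨x, rfl⟩ := S.cls_surjective _ x
    obtain ⟨y, rfl⟩ := S.cls_surjective _ y
    obtain ⟨z, rfl⟩ := S.cls_surjective _ z
    refine congrArg (S.cls (m + n))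
      (?_ : S.cupCocycle (x + y) z = S.cupCocycle x z + S.cupCocycle y z)
    apply Subtype.ext; ext a; exact add_mul _ _ _
  one_mul := by
    rintro ⟨n, x⟩
    obtain ⟨x, rfl⟩ := S.cls_surjective _ x
    refine S.gradedMk_eq (x := S.cupCocycle S.oneCocycle x) (y := x) (zero_add n) fun a => ?_
    refine (ev_cup _ _ a).trans ?_
    simp only [zero_add]
    exact one_mul _
  mul_one := by
    rintro ⟨n, x⟩
    obtain ⟨x, rfl⟩ := S.cls_surjective _ x
    refine S.gradedMk_eq (x := S.cupCocycle x S.oneCocycle) (y := x) (add_zero n) fun a => ?_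
    exact (ev_cup _ _ a).trans (mul_one _)
  mul_assoc := by
    rintro ⟨l, x⟩ ⟨m, y⟩ ⟨n, z⟩
    obtain ⟨x, rfl⟩ := S.cls_surjective _ x
    obtain ⟨y, rfl⟩ := S.cls_surjective _ y
    obtain ⟨z, rfl⟩ := S.cls_surjective _ z
    refine S.gradedMk_eq (x := S.cupCocycle (S.cupCocycle x y) z)
      (y := S.cupCocycle x (S.cupCocycle y z)) (add_assoc l m n) fun a => ?_
    simp only [cupCocycle, ev_cup, mul_assoc, add_assoc]
  natCast c := c • S.cls 0 S.oneCocycle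
  natCast_zero := zero_smul _ _
  natCast_succ c := succ_nsmul _ _
  intCast c := c • S.cls 0 S.oneCocycle
  intCast_ofNat c := natCast_zsmul _ _
  intCast_negSucc_ofNat c := negSucc_zsmul _ _

instance instGAlgebra : DirectSum.GAlgebra k S.Cohomology where
  toFun := (LinearMap.toSpanSingleton k (S.Cohomology 0) (S.cls 0 S.oneCocycle)).toAddMonoidHom
  map_one := one_smul k (S.cls 0 S.oneCocycle)
  map_mul r s := by
    refine S.gradedMk_eq (x := (r * s) • S.oneCocycle)
      (y := S.cupCocycle (r • S.oneCocycle) (s • S.oneCocycle)) rfl fun a => ?_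
    rw [cupCocycle, ev_cup]
    change (r * s) • (1 : A) = (r • (1 : A)) * (s • (1 : A))
    rw [smul_mul_smul_comm, one_mul]
  commutes r := by
    rintro ⟨n, x⟩
    obtain ⟨x, rfl⟩ := S.cls_surjective _ x
    refine S.gradedMk_eq (x := S.cupCocycle (r • S.oneCocycle) x)
      (y := S.cupCocycle x (r • S.oneCocycle)) (by omega) fun a => ?_
    simp only [cupCocycle, ev_cup, zero_add]
    change (r • (1 : A)) * x.1.ev a = x.1.ev a * (r • (1 : A))
    rw [smul_mul_assoc, mul_smul_comm, one_mul, mul_one]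
  smul_def r := by
    rintro ⟨n, x⟩
    obtain ⟨x, rfl⟩ := S.cls_surjective _ x
    refine S.gradedMk_eq (x := r • x) (y := S.cupCocycle (r • S.oneCocycle) x)
      (by omega) fun a => ?_
    simp only [cupCocycle, ev_cup, zero_add]
    change r • x.1.ev a = (r • (1 : A)) * x.1.ev a
    rw [smul_mul_assoc, one_mul]

/-- The cohomology algebra `H^*(S) = ⨁ₙ H^n(S)`, with the cup product. -/
abbrev CohomologyAlgebra : Type _ := ⨁ n : ℕ, S.Cohomology n

/-- The whole cochain algebra `C^•(A)`. -/
def full (k : Type*) (A : Type*) [Field k] [Ring A] [Algebra k A] :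
    HochschildDGSubalgebra k A where
  carrier _ := ⊤
  one_mem := trivial
  cup_mem _ _ := trivial
  d_mem _ := trivial

end HochschildDGSubalgebra

open HochschildDGSubalgebra

/-- The Hochschild cohomology space `HH^n(A)`. -/
abbrev HochschildCohomology (k : Type*) (A : Type*) [Field k] [Ring A] [Algebra k A] (n : ℕ) :
    Type _ := (full k A).Cohomology n

/-- The Hochschild cohomology algebra `HH^*(A) = ⨁ₙ HH^n(A)`, with the cup product. -/
abbrev HochschildCohomologyAlgebra (k : Type*) (A : Type*) [Field k] [Ring A] [Algebra k A] :
    Type _ := (full k A).CohomologyAlgebra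

/-! ### The action of a group of automorphisms on Hochschild cohomology -/

namespace HochschildCohomology

variable {k : Type*} {A : Type*} [Field k] [Ring A] [Algebra k A]

/-- The action of an algebra automorphism on cocycles. -/
def conjCocycles (σ : A ≃ₐ[k] A) (n : ℕ) :
    (full k A).cocycles n →ₗ[k] (full k A).cocycles n :=
  (conj σ n).restrict fun φ hφ => ⟨trivial, by
    change d n (conj σ n φ) = 0
    rw [← conj_d, show d n φ = 0 from hφ.2, map_zero]⟩

/-- The action of an algebra automorphism on `HH^n(A)`, induced by its action on cochains. -/
def conjCohomology (σ : A ≃ₐ[k] A) (n : ℕ) :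
    HochschildCohomology k A n →ₗ[k] HochschildCohomology k A n :=
  Submodule.mapQ _ _ (conjCocycles σ n) <| by
    intro x hx
    change conj σ n x.1 ∈ (full k A).coboundaries n
    change x.1 ∈ (full k A).coboundaries n at hx
    cases n with
    | zero =>
      rw [(Submodule.mem_bot k).1 hx, map_zero]
      exact Submodule.zero_mem _
    | succ n =>
      obtain ⟨c, _, hc⟩ := hx
      rw [← hc, conj_d]
      exact ⟨conj σ n c, trivial, rfl⟩

theorem conjCohomology_cls (σ : A ≃ₐ[k] A) (n : ℕ) (x : (full k A).cocycles n) :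
    conjCohomology σ n ((full k A).cls n x) = (full k A).cls n (conjCocycles σ n x) := rfl

/-- The action of an algebra automorphism on the algebra `HH^*(A)`. -/
def conjAlgHom (σ : A ≃ₐ[k] A) :
    HochschildCohomologyAlgebra k A →ₐ[k] HochschildCohomologyAlgebra k A :=
  DirectSum.toAlgebra k (HochschildCohomology k A)
    (fun n => (DirectSum.lof k ℕ (HochschildCohomology k A) n).comp (conjCohomology σ n))
    (by
      refine congrArg (DirectSum.of (HochschildCohomology k A) 0)
        (congrArg ((full k A).cls 0) (Subtype.ext (conj_one σ))))
    (by
      intro m n x y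
      obtain ⟨x, rfl⟩ := (full k A).cls_surjective _ x
      obtain ⟨y, rfl⟩ := (full k A).cls_surjective _ y
      simp only [LinearMap.comp_apply, DirectSum.lof_eq_of, DirectSum.of_mul_of]
      exact congrArg (DirectSum.of (HochschildCohomology k A) (m + n))
        (congrArg ((full k A).cls (m + n)) (Subtype.ext (conj_cup σ x.1 y.1))))

theorem conjAlgHom_of (σ : A ≃ₐ[k] A) (n : ℕ) (x : HochschildCohomology k A n) :
    conjAlgHom σ (DirectSum.of (HochschildCohomology k A) n x) =
      DirectSum.of (HochschildCohomology k A) n (conjCohomology σ n x) :=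
  DirectSum.toAddMonoid_of _ _ _

/-- The group of algebra automorphisms of `A` acts on `HH^*(A)` by algebra endomorphisms. -/
def conjMonoidHom : (A ≃ₐ[k] A) →*
    (HochschildCohomologyAlgebra k A →ₐ[k] HochschildCohomologyAlgebra k A) where
  toFun := conjAlgHom
  map_one' := DirectSum.algHom_ext _ _ fun n x => by
    obtain ⟨x, rfl⟩ := (full k A).cls_surjective _ x
    exact conjAlgHom_of _ _ _
  map_mul' σ τ := DirectSum.algHom_ext _ _ fun n x => by
    obtain ⟨x, rfl⟩ := (full k A).cls_surjective _ x
    rw [AlgHom.mul_apply, conjAlgHom_of, conjAlgHom_of, conjAlgHom_of]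
    rfl

variable (k A) in
/-- The algebra of invariants `HH^*(A)^G`, for a group `G` acting on `A` by algebra automorphisms:
the `x ∈ HH^*(A)` such that `s·x = x` for all `s ∈ G`. -/
def invariants (G : Type*) [Group G] [MulSemiringAction G A] [SMulCommClass G k A] :
    Subalgebra k (HochschildCohomologyAlgebra k A) :=
  ⨅ s : G, AlgHom.equalizer (conjMonoidHom (MulSemiringAction.toAlgEquiv k A s)) (AlgHom.id k _)

end HochschildCohomology

/-! ### Graded algebras and the component of a conjugacy class -/

/-- A grading of the `k`-algebra `B` by the group `G`: `B = ⨁_{s ∈ G} B_s`, with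
`B_s B_t ⊆ B_{st}` and `1 ∈ B_1`. -/
class GroupGrading {k : Type*} {B : Type*} {G : Type*} [Field k] [Ring B] [Algebra k B] [Group G]
    (𝒜 : G → Submodule k B) : Prop where
  iSupIndep : iSupIndep 𝒜
  iSup_eq_top : ⨆ s, 𝒜 s = ⊤
  one_mem : (1 : B) ∈ 𝒜 1
  mul_mem : ∀ {s t : G} {x y : B}, x ∈ 𝒜 s → y ∈ 𝒜 t → x * y ∈ 𝒜 (s * t)

namespace GroupGrading

variable {k : Type*} {B : Type*} {G : Type*} [Field k] [Ring B] [Algebra k B] [Group G]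
variable (𝒜 : G → Submodule k B)

/-- The cochains of degree `n` belonging to the conjugacy class `D`: those `φ` which send a
tuple of homogeneous elements of degrees `s₁, …, s_n` to a sum of homogeneous elements whose
degrees `g` are such that `s₁ ⋯ s_n g⁻¹ ∈ D`. -/
def classCochains (D : ConjClasses G) (n : ℕ) : Submodule k (HochschildCochain k B n) where
  carrier := {φ | ∀ (s : Fin n → G) (b : Fin n → B), (∀ i, b i ∈ 𝒜 (s i)) →
    φ b ∈ ⨆ (g : G) (_ : ConjClasses.mk ((List.ofFn s).prod * g⁻¹) = D), 𝒜 g}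
  add_mem' hφ hψ s b hb := Submodule.add_mem _ (hφ s b hb) (hψ s b hb)
  zero_mem' _ _ _ := Submodule.zero_mem _
  smul_mem' c _ hφ s b hb := Submodule.smul_mem _ c (hφ s b hb)

theorem mem_classCochains_one {n : ℕ} {φ : HochschildCochain k B n} :
    φ ∈ classCochains 𝒜 1 n ↔ ∀ (s : Fin n → G) (b : Fin n → B), (∀ i, b i ∈ 𝒜 (s i)) →
      φ b ∈ 𝒜 (List.ofFn s).prod := by
  have h : ∀ p : G, (⨆ (g : G) (_ : ConjClasses.mk (p * g⁻¹) = 1), 𝒜 g) = 𝒜 p := by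
    intro p
    have h1 : ∀ g : G, ConjClasses.mk (p * g⁻¹) = 1 ↔ g = p := by
      intro g
      rw [ConjClasses.one_eq_mk_one, ConjClasses.mk_eq_mk_iff_isConj, isConj_one_left,
        mul_inv_eq_one, eq_comm]
    simp only [h1, iSup_iSup_eq_left]
  change (∀ (s : Fin n → G) (b : Fin n → B), (∀ i, b i ∈ 𝒜 (s i)) → φ b ∈ _) ↔ _
  simp only [h]

theorem prod_contractNth : ∀ {n : ℕ} (i : Fin n) (s : Fin (n + 1) → G),
    (List.ofFn (Fin.contractNth i.castSucc (· * ·) s)).prod = (List.ofFn s).prod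
  | 0, i, _ => i.elim0
  | n + 1, i, s => by
    induction i using Fin.cases with
    | zero =>
      rw [List.ofFn_succ, List.ofFn_succ (f := s), List.ofFn_succ (f := fun j => s j.succ)]
      simp [Fin.contractNth, mul_assoc]
    | succ i =>
      have h : (fun j : Fin n => Fin.contractNth i.succ.castSucc (· * ·) s j.succ) =
          Fin.contractNth i.castSucc (· * ·) (fun j => s j.succ) := by
        funext j
        simp [Fin.contractNth]
      rw [List.ofFn_succ, List.ofFn_succ (f := s), List.prod_cons, List.prod_cons, h,
        prod_contractNth i]
      simp [Fin.contractNth]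

variable [GroupGrading 𝒜]

/-- The trivial conjugacy class component of `C^•(B)` is a differential graded subalgebra. -/
def trivialClassCochains : HochschildDGSubalgebra k B where
  carrier := classCochains 𝒜 1
  one_mem := by
    rw [mem_classCochains_one]
    intro s b _
    simpa using! one_mem (𝒜 := 𝒜)
  cup_mem {m n ψ φ} hψ hφ := by
    rw [mem_classCochains_one] at *
    intro s b hb
    rw [cup_apply, List.ofFn_add, List.prod_append]
    exact mul_mem (hψ _ _ fun i => hb _) (hφ _ _ fun i => hb _)
  d_mem {n φ} hφ := by
    rw [mem_classCochains_one] at *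
    intro s b hb
    rw [d_apply]
    refine Submodule.add_mem _ (Submodule.add_mem _ ?_ (Submodule.sum_mem _ fun i _ => ?_)) ?_
    · rw [List.ofFn_succ, List.prod_cons]
      exact mul_mem (hb _) (hφ _ _ fun i => hb _)
    · refine Submodule.smul_mem _ _ ?_
      rw [← prod_contractNth i s]
      refine hφ _ _ fun j => ?_
      simp only [Fin.contractNth]
      split_ifs
      · exact hb _
      · exact mul_mem (hb _) (hb _)
      · exact hb _
    · refine Submodule.smul_mem _ _ ?_
      rw [List.ofFn_succ', List.concat_eq_append, List.prod_append, List.prod_singleton]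
      exact mul_mem (hφ _ _ fun i => hb _) (hb _)

/-- The algebra `HH^*_{1}(B)`: the cohomology of the trivial conjugacy class component of the
Hochschild cochain algebra of the graded algebra `B`. -/
abbrev TrivialClassCohomologyAlgebra : Type _ := (trivialClassCochains 𝒜).CohomologyAlgebra

end GroupGrading

/-! ### The grading of the skew group algebra -/

namespace SkewGroupAlgebra

variable (k : Type*) (A : Type*) {G : Type*} [Field k] [Ring A] [Algebra k A] [Group G]
variable [MulSemiringAction G A] [SMulCommClass G k A]

/-- The component of degree `s` of the skew group algebra `A[G]`: the elements `a ⊗ s`. -/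
def component (s : G) : Submodule k (SkewMonoidAlgebra A G) :=
  LinearMap.range (SkewMonoidAlgebra.lsingle (R := k) s : A →ₗ[k] SkewMonoidAlgebra A G)

theorem component_isInternal [DecidableEq G] :
    DirectSum.IsInternal (component k A (G := G)) := by
  let f : SkewMonoidAlgebra A G →ₗ[k] ⨁ s, component k A (G := G) s :=
    (Finsupp.lsum k fun s => (DirectSum.lof k G (fun s => component k A (G := G) s) s).comp
      (SkewMonoidAlgebra.lsingle (R := k) s : A →ₗ[k] SkewMonoidAlgebra A G).rangeRestrict).comp
      (SkewMonoidAlgebra.coeffLinearEquiv :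
        SkewMonoidAlgebra A G ≃ₗ[k] (G →₀ A)).toLinearMap
  have hf : ∀ s a, f (SkewMonoidAlgebra.single s a) =
      DirectSum.lof k G (fun s => component k A (G := G) s) s
        ⟨SkewMonoidAlgebra.single s a, a, rfl⟩ := by
    intro s a
    change Finsupp.lsum k _ (Finsupp.single s a) = _
    rw [Finsupp.lsum_single]
    rfl
  have h1 : (DirectSum.coeLinearMap (component k A (G := G))).comp f = LinearMap.id := by
    refine SkewMonoidAlgebra.lhom_ext fun s a => ?_
    rw [LinearMap.comp_apply, hf, DirectSum.coeLinearMap_lof]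
    rfl
  have h2 : f.comp (DirectSum.coeLinearMap (component k A (G := G))) = LinearMap.id := by
    refine DirectSum.linearMap_ext _ fun s => LinearMap.ext ?_
    rintro ⟨_, a, rfl⟩
    rw [LinearMap.comp_apply, LinearMap.comp_apply, DirectSum.coeLinearMap_lof]
    exact hf s a
  exact Function.bijective_iff_has_inverse.2
    ⟨f, fun x => LinearMap.congr_fun h2 x, fun x => LinearMap.congr_fun h1 x⟩

instance : GroupGrading (component k A (G := G)) where
  iSupIndep := by
    classical exact (component_isInternal k A).submodule_iSupIndep
  iSup_eq_top := by
    classical exact (component_isInternal k A).submodule_iSup_eq_top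
  one_mem := ⟨1, rfl⟩
  mul_mem := by
    rintro s t _ _ ⟨a, rfl⟩ ⟨b, rfl⟩
    exact ⟨a * s • b, (SkewMonoidAlgebra.single_mul_single).symm⟩

end SkewGroupAlgebra

end

/-!
Write `A = Λ` and `A[G]` for the skew group algebra. A cochain `φ` of `A[G]` which belongs to the
trivial conjugacy class has *homogeneous coordinates*: for `g₀, …, g_n ∈ G` the product
`g₀ φ(g₀⁻¹ x₁ g₁, g₁⁻¹ x₂ g₂, …, g_{n-1}⁻¹ x_n g_n) g_n⁻¹` lies in `A`, and it is a cochain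
`F(g₀, …, g_n)` of `A` in the variables `x₁, …, x_n`. In this way the complex of the trivial
conjugacy class becomes the complex of `G`-equivariant families `F` (`ext_homFamily`,
`homFamily_ofFamily`), and the Hochschild coboundary becomes the alternating sum of faces which
omit one `g_j` and multiply the neighbouring `x`'s (`ev_homFamily_d`).

Restriction of cochains to `A` is evaluation at `g₀ = ⋯ = g_n = 1`. It is multiplicative and
commutes with the coboundary, so it induces a homomorphism `restrictAlgHom` of graded algebras from
the cohomology of the trivial conjugacy class to `HH^*(A)`. In the other direction an invariant
cochain of `A` is a constant equivariant family, and this gives a chain map `extendCochain` which is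
a section of the restriction.

The families `F` and `F(t, …, t)`, for a fixed `t ∈ G`, are homotopic through
`h F (g₀, …, g_{n-1})(x₁, …, x_{n-1}) =
∑_i (-1)^i F(g₀, …, g_i, t, …, t)(x₁, …, x_i, 1, x_{i+1}, …, x_{n-1})` (`sum_face_degenerate`).
For a single `t` this homotopy is not equivariant, but its average over `t ∈ G` is. As
`F(t, …, t)` is the translate by `t` of the restriction of `φ`, a cocycle `φ` is cohomologous to the
extension of the average of its restriction (`sub_extendCochain_mem_coboundaries`). Hence the
restriction is injective in cohomology and its image consists of invariant classes. Conversely an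
invariant class is represented by an invariant cocycle, its average, which is the restriction of its
extension.
-/

open scoped DirectSum
open HochschildCochain HochschildDGSubalgebra

noncomputable section

/-! ### Alternating double sums -/

/-- The combinatorial identity behind simplicial homotopies. The elements `A i j` stand for the
`j`-th face of the `i`-th degeneracy, and `B j i` for the same operators in the opposite order.
The terms off the two diagonals `j = i` and `j = i + 1` cancel against `B`, and the diagonals
telescope. -/
theorem sum_simplicial_homotopy {k M : Type*} [CommRing k] [AddCommGroup M] [Module k M] (n : ℕ)
    (A B : ℕ → ℕ → M) (hlt : ∀ i < n, ∀ j ≤ i, A (i + 1) j = B j i)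
    (hgt : ∀ i < n, ∀ j, i < j → j ≤ n → A i (j + 1) = B j i)
    (hdiag : ∀ i < n, A (i + 1) (i + 1) = A i (i + 1)) :
    ∑ i ∈ Finset.range (n + 1), ∑ j ∈ Finset.range (n + 2), (-1 : k) ^ (i + j) • A i j +
      ∑ j ∈ Finset.range (n + 1), ∑ i ∈ Finset.range n, (-1 : k) ^ (i + j) • B j i =
    A 0 0 - A n (n + 1) := by
  let L : ℕ → M := fun i => ∑ j ∈ Finset.Ico 0 i, (-1 : k) ^ (i + j) • A i j
  let U : ℕ → M := fun i => ∑ j ∈ Finset.Ico (i + 1) (n + 1), (-1 : k) ^ (i + (j + 1)) • A i (j + 1)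
  have hrow : ∀ i ∈ Finset.range (n + 1), ∑ j ∈ Finset.range (n + 2), (-1 : k) ^ (i + j) • A i j =
      L i + (A i i - A i (i + 1)) + U i := by
    intro i hi
    rw [Finset.mem_range] at hi
    have hU : U i = ∑ j ∈ Finset.Ico (i + 2) (n + 2), (-1 : k) ^ (i + j) • A i j :=
      Finset.sum_Ico_add' (fun j => (-1 : k) ^ (i + j) • A i j) (i + 1) (n + 1) 1
    rw [hU, Finset.range_eq_Ico, ← Finset.sum_Ico_consecutive _ (Nat.zero_le i) (by omega),
      Finset.sum_eq_sum_Ico_succ_bot (by omega : i < n + 2),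
      Finset.sum_eq_sum_Ico_succ_bot (by omega : i + 1 < n + 2), ← add_assoc i i 1, pow_succ,
      Even.neg_one_pow ⟨i, rfl⟩]
    module
  have hcol : ∀ i ∈ Finset.range n, ∑ j ∈ Finset.range (n + 1), (-1 : k) ^ (i + j) • B j i =
      -(L (i + 1) + U i) := by
    intro i hi
    rw [Finset.mem_range] at hi
    rw [Finset.range_eq_Ico, ← Finset.sum_Ico_consecutive _ (Nat.zero_le (i + 1)) (by omega),
      neg_add, ← Finset.sum_neg_distrib, ← Finset.sum_neg_distrib]
    refine congrArg₂ (· + ·) (Finset.sum_congr rfl fun j hj => ?_)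
      (Finset.sum_congr rfl fun j hj => ?_)
    · rw [Finset.mem_Ico] at hj
      rw [hlt i hi j (by omega), add_right_comm, pow_succ]
      module
    · rw [Finset.mem_Ico] at hj
      rw [hgt i hi j (by omega) (by omega), ← add_assoc, pow_succ]
      module
  have hL : L 0 = 0 := Finset.sum_eq_zero fun j hj => by simp at hj
  have hU : U n = 0 := Finset.sum_eq_zero fun j hj => by simp at hj
  have htel : ∑ i ∈ Finset.range n, (A (i + 1) (i + 1) - A i i) = A n n - A 0 0 :=
    Finset.sum_range_sub (fun i => A i i) n
  have htel' : ∑ i ∈ Finset.range n, A i (i + 1) = A n n - A 0 0 + ∑ i ∈ Finset.range n, A i i := by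
    rw [← htel, ← Finset.sum_add_distrib]
    refine Finset.sum_congr rfl fun i hi => ?_
    rw [hdiag i (Finset.mem_range.1 hi), sub_add_cancel]
  rw [Finset.sum_comm (s := Finset.range (n + 1)) (t := Finset.range n), Finset.sum_congr rfl hcol,
    Finset.sum_congr rfl hrow]
  simp only [Finset.sum_add_distrib, Finset.sum_neg_distrib, Finset.sum_sub_distrib]
  rw [Finset.sum_range_succ' L, Finset.sum_range_succ U, hL, hU,
    Finset.sum_range_succ (fun i => A i (i + 1)), htel', Finset.sum_range_succ (fun i => A i i)]
  abel

/-! ### Insertion of a unit and averages of cochains -/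

namespace HochschildCochain

variable {k : Type*} {A : Type*} [Field k] [Ring A] [Algebra k A]

theorem ev_congr {n : ℕ} (φ : HochschildCochain k A n) {a b : ℕ → A}
    (h : ∀ i < n, a i = b i) : φ.ev a = φ.ev b :=
  congrArg φ (funext fun i => h i i.2)

theorem ev_sub {n : ℕ} (φ ψ : HochschildCochain k A n) (a : ℕ → A) :
    (φ - ψ).ev a = φ.ev a - ψ.ev a := rfl

theorem ev_smul {n : ℕ} (c : k) (φ : HochschildCochain k A n) (a : ℕ → A) :
    (c • φ).ev a = c • φ.ev a := rfl

theorem ev_sum {n : ℕ} {ι : Type*} (s : Finset ι) (φ : ι → HochschildCochain k A n) (a : ℕ → A) :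
    (∑ i ∈ s, φ i).ev a = ∑ i ∈ s, (φ i).ev a := by
  simp only [ev, sum_apply]

theorem ev_conj (σ : A ≃ₐ[k] A) {n : ℕ} (φ : HochschildCochain k A n) (a : ℕ → A) :
    (conj σ n φ).ev a = σ (φ.ev fun i => σ.symm (a i)) := rfl

/-- Inserting `1` in position `i` of a sequence. -/
def insertOneSeq (i : ℕ) (a : ℕ → A) (l : ℕ) : A :=
  if l < i then a l else if l = i then 1 else a (l - 1)

/-- The cochain `(a₁, …, a_n) ↦ φ(a₁, …, a_i, 1, a_{i+1}, …, a_n)`. -/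
def insertOne {n : ℕ} (i : Fin (n + 1)) (φ : HochschildCochain k A (n + 1)) :
    HochschildCochain k A n :=
  φ.curryMid i 1

theorem ev_insertOne {n : ℕ} (i : Fin (n + 1)) (φ : HochschildCochain k A (n + 1)) (a : ℕ → A) :
    (insertOne i φ).ev a = φ.ev (insertOneSeq i a) := by
  refine congrArg φ (funext fun l => ?_)
  induction l using Fin.succAboveCases i with
  | x => simp [insertOneSeq]
  | p l =>
    rw [Fin.insertNth_apply_succAbove]
    rcases lt_or_ge l.castSucc i with h | h
    · rw [Fin.succAbove_of_castSucc_lt _ _ h, insertOneSeq, if_pos (Fin.lt_def.1 h)]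
      rfl
    · rw [Fin.succAbove_of_le_castSucc _ _ h, insertOneSeq]
      rw [Fin.le_def, Fin.val_castSucc] at h
      rw [if_neg (by rw [Fin.val_succ]; omega), if_neg (by rw [Fin.val_succ]; omega)]
      rfl

variable (G : Type*) [Group G] [MulSemiringAction G A] [SMulCommClass G k A]

/-- A cochain is invariant if it is fixed by the action of every `s ∈ G`. -/
def IsInvariant {n : ℕ} (φ : HochschildCochain k A n) : Prop :=
  ∀ s : G, conj (MulSemiringAction.toAlgEquiv k A s) n φ = φ

variable {G} in
theorem IsInvariant.ev_smul {n : ℕ} {φ : HochschildCochain k A n} (h : IsInvariant G φ) (s : G)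
    (a : ℕ → A) : φ.ev (fun i => s • a i) = s • φ.ev a := by
  conv_lhs => rw [← h s]
  rw [ev_conj]
  change s • φ.ev (fun i => s⁻¹ • s • a i) = _
  simp only [inv_smul_smul]

variable {G} in
theorem IsInvariant.d {n : ℕ} {φ : HochschildCochain k A n} (h : IsInvariant G φ) :
    IsInvariant G (d n φ) := fun s => by rw [conj_d, h s]

variable [Fintype G]

variable (k A) in
/-- The average `|G|⁻¹ ∑ s·φ` of a cochain over `G`. It is only meaningful if `|G|` is invertible in
`k`; otherwise it is zero. -/
def avg (n : ℕ) : HochschildCochain k A n →ₗ[k] HochschildCochain k A n :=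
  (Fintype.card G : k)⁻¹ • ∑ s : G, conj (MulSemiringAction.toAlgEquiv k A s) n

theorem avg_apply {n : ℕ} (φ : HochschildCochain k A n) :
    avg k A G n φ =
      (Fintype.card G : k)⁻¹ • ∑ s : G, conj (MulSemiringAction.toAlgEquiv k A s) n φ := by
  simp [avg]

theorem isInvariant_avg {n : ℕ} (φ : HochschildCochain k A n) :
    IsInvariant G (avg k A G n φ) := fun t => by
  rw [avg_apply, map_smul, map_sum]
  congr 1
  refine Fintype.sum_equiv (Equiv.mulLeft t) _ _ fun s => ?_
  change _ = conj (MulSemiringAction.toAlgAut G k A (t * s)) n φ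
  rw [map_mul, conj_mul]
  rfl

theorem avg_d {n : ℕ} (φ : HochschildCochain k A n) :
    avg k A G (n + 1) (d n φ) = d n (avg k A G n φ) := by
  simp only [avg_apply, map_smul, map_sum, conj_d]

end HochschildCochain

/-! ### Faces of families of functions and the contracting homotopy -/

namespace HochschildCochain

section Face

variable {k A G : Type*} [Field k] [Ring A] [Algebra k A]

/-- Omitting the entry `j` of a sequence. -/
def skip (j : ℕ) (g : ℕ → G) (l : ℕ) : G := if l < j then g l else g (l + 1)

/-- The sequence `g₀, …, g_i, t, t, …`. -/
def fillSeq (t : G) (i : ℕ) (g : ℕ → G) (l : ℕ) : G := if l ≤ i then g l else t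

/-- The `j`-th face, `0 ≤ j ≤ n + 1`, of a family `F` of functions of `x₁, …, x_n` indexed by
`g₀, …, g_n`. -/
def face (n : ℕ) (F : (ℕ → G) → (ℕ → A) → A) (j : ℕ) (g : ℕ → G) (x : ℕ → A) : A :=
  if j = 0 then x 0 * F (fun l => g (l + 1)) (fun l => x (l + 1))
  else if j = n + 1 then F g x * x n
  else F (skip j g) (contr (j - 1) x)

theorem face_zero (n : ℕ) (F : (ℕ → G) → (ℕ → A) → A) (g : ℕ → G) (x : ℕ → A) :
    face n F 0 g x = x 0 * F (fun l => g (l + 1)) (fun l => x (l + 1)) := if_pos rfl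

theorem face_last (n : ℕ) (F : (ℕ → G) → (ℕ → A) → A) (g : ℕ → G) (x : ℕ → A) :
    face n F (n + 1) g x = F g x * x n := by
  rw [face, if_neg (by omega), if_pos rfl]

theorem face_succ {n j : ℕ} (hj : j < n) (F : (ℕ → G) → (ℕ → A) → A) (g : ℕ → G) (x : ℕ → A) :
    face n F (j + 1) g x = F (skip (j + 1) g) (contr j x) := by
  rw [face, if_neg (by omega), if_neg (by omega), Nat.add_sub_cancel]

theorem face_smul (n : ℕ) (c : k) (F : (ℕ → G) → (ℕ → A) → A) (j : ℕ) (g : ℕ → G) (x : ℕ → A) :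
    face n (fun g x => c • F g x) j g x = c • face n F j g x := by
  simp only [face, mul_smul_comm, smul_mul_assoc, smul_ite]

theorem face_sum {ι : Type*} (n : ℕ) (s : Finset ι) (F : ι → (ℕ → G) → (ℕ → A) → A) (j : ℕ)
    (g : ℕ → G) (x : ℕ → A) :
    face n (fun g x => ∑ i ∈ s, F i g x) j g x = ∑ i ∈ s, face n (F i) j g x := by
  simp only [face, Finset.mul_sum, Finset.sum_mul]
  split_ifs <;> rfl

/-- The alternating sum of the faces of a constant family is the Hochschild coboundary. -/
theorem sum_face_const {n : ℕ} (φ : HochschildCochain k A n) (g : ℕ → G) (x : ℕ → A) :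
    ∑ j ∈ Finset.range (n + 2), (-1 : k) ^ j • face n (fun _ x => φ.ev x) j g x =
      (d n φ).ev x := by
  have hmid : ∀ j ∈ Finset.range n, (-1 : k) ^ (j + 1) • face n (fun _ x => φ.ev x) (j + 1) g x =
      (-1 : k) ^ (j + 1) • φ.ev (contr j x) := fun j hj => by
    rw [face_succ (Finset.mem_range.1 hj)]
  rw [ev_d, Finset.sum_range_succ, Finset.sum_range_succ', face_zero, face_last, pow_zero,
    one_smul, Finset.sum_congr rfl hmid, add_comm (∑ _ ∈ _, _)]

/-- The family `F` with `g₀, …, g_i, t, …, t` and `x₁, …, x_i, 1, x_{i+1}, …` substituted. -/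
def degenerate (F : (ℕ → G) → (ℕ → A) → A) (t : G) (i : ℕ) (g : ℕ → G) (x : ℕ → A) : A :=
  F (fillSeq t i g) (insertOneSeq i x)

/-- Faces omitting one of `g₀, …, g_i` commute with the degeneracy at `i + 1`, up to a shift. -/
theorem face_degenerate_of_le {n i j : ℕ} (hj : j ≤ i) (hi : i < n)
    (F : (ℕ → G) → (ℕ → A) → A) (t : G) (g : ℕ → G) (x : ℕ → A) :
    face n F j (fillSeq t (i + 1) g) (insertOneSeq (i + 1) x) =
      face (n - 1) (fun g x => degenerate F t i g x) j g x := by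
  cases j with
  | zero =>
    rw [face_zero, face_zero, degenerate]
    congr 2
    · funext l; simp [fillSeq]
    · funext l; simp only [insertOneSeq]
      split_ifs <;> first | rfl | omega | (congr 1; omega)
  | succ j =>
    rw [face_succ (by omega), face_succ (by omega), degenerate]
    congr 1
    · funext l
      simp only [skip, fillSeq]
      split_ifs <;> first | rfl | omega
    · funext l
      simp only [contr, insertOneSeq]
      split_ifs <;> first | rfl | omega | (congr 1; omega)

/-- Faces omitting a copy of `t` other than the first one amount to faces omitting one of
`g_{i+1}, …, g_n`. -/
theorem face_degenerate_of_lt {n i j : ℕ} (hi : i < j) (hj : j ≤ n)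
    (F : (ℕ → G) → (ℕ → A) → A) (t : G) (g : ℕ → G) (x : ℕ → A) :
    face n F (j + 1) (fillSeq t i g) (insertOneSeq i x) =
      face (n - 1) (fun g x => degenerate F t i g x) j g x := by
  obtain rfl | hj := hj.eq_or_lt
  · obtain ⟨j, rfl⟩ : ∃ m, j = m + 1 := ⟨j - 1, by omega⟩
    rw [face_last, Nat.add_sub_cancel, face_last, degenerate, insertOneSeq,
      if_neg (by omega), if_neg (by omega), Nat.add_sub_cancel]
  · obtain ⟨j, rfl⟩ : ∃ m, j = m + 1 := ⟨j - 1, by omega⟩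
    rw [face_succ hj, face_succ (by omega), degenerate]
    congr 1
    · funext l
      simp only [skip, fillSeq]
      split_ifs <;> first | rfl | omega
    · funext l
      simp only [contr, insertOneSeq]
      split_ifs <;> first | rfl | omega | (congr 1; omega) | (congr 2; omega)

/-- Omitting `g_{i+1}` from `g₀, …, g_{i+1}, t, …, t` or the first `t` from `g₀, …, g_i, t, …, t`
gives the same sequence, and in both cases the inserted `1` is multiplied with `x_{i+1}`. -/
theorem face_degenerate_diag {n i : ℕ} (hi : i < n)
    (F : (ℕ → G) → (ℕ → A) → A) (t : G) (g : ℕ → G) (x : ℕ → A) :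
    face n F (i + 1) (fillSeq t (i + 1) g) (insertOneSeq (i + 1) x) =
      face n F (i + 1) (fillSeq t i g) (insertOneSeq i x) := by
  rw [face_succ hi, face_succ hi]
  congr 1
  · funext l
    simp only [skip, fillSeq]
    split_ifs <;> first | rfl | omega
  · funext l
    rcases lt_trichotomy l i with h | rfl | h
    · simp [contr, insertOneSeq, h, (by omega : l < i + 1)]
    · simp [contr, insertOneSeq]
    · simp only [contr, insertOneSeq]
      split_ifs <;> first | rfl | omega

/-- The homotopy between a family `F` of degree `n` and its value at a constant sequence `t`:
the alternating sums over the degeneracies and over the faces commute up to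
`F(t, …, t) - F(g₀, …, g_n)`. For `n = 0` the second double sum is empty, so that the truncated
difference `n - 1` plays no role. -/
theorem sum_face_degenerate {n : ℕ} {F : (ℕ → G) → (ℕ → A) → A}
    (hF : ∀ g g' : ℕ → G, ∀ x x' : ℕ → A, (∀ i ≤ n, g i = g' i) → (∀ i < n, x i = x' i) →
      F g x = F g' x') (t : G) (g : ℕ → G) (x : ℕ → A) :
    ∑ i ∈ Finset.range (n + 1), ∑ j ∈ Finset.range (n + 2),
        (-1 : k) ^ (i + j) • face n F j (fillSeq t i g) (insertOneSeq i x) +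
      ∑ j ∈ Finset.range (n + 1), ∑ i ∈ Finset.range n,
        (-1 : k) ^ (i + j) • face (n - 1) (fun g x => degenerate F t i g x) j g x =
    F (fun _ => t) x - F g x := by
  rw [sum_simplicial_homotopy n (fun i j => face n F j (fillSeq t i g) (insertOneSeq i x))
    (fun j i => face (n - 1) (fun g x => degenerate F t i g x) j g x)
    (fun i hi j hj => face_degenerate_of_le hj hi F t g x)
    (fun i _ j hij hj => face_degenerate_of_lt hij hj F t g x)
    (fun i hi => face_degenerate_diag hi F t g x), face_zero, face_last]
  congr 1
  · simp only [insertOneSeq, lt_irrefl, if_false, if_true, one_mul]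
    congr 1
  · rw [insertOneSeq, if_neg (lt_irrefl n), if_pos rfl, mul_one]
    exact hF _ _ _ _ (fun i hi => if_pos hi) (fun i hi => if_pos hi)

end Face

end HochschildCochain

/-! ### Cochains of the skew group algebra in homogeneous coordinates -/

namespace SkewGroupAlgebra

variable (k : Type*) {A : Type*} {G : Type*} [Field k] [Ring A] [Algebra k A] [Group G]
variable [MulSemiringAction G A] [SMulCommClass G k A]

/-- The action of `s` on `A`, as a linear map. -/
abbrev actLin (s : G) : A →ₗ[k] A := DistribSMul.toLinearMap k A s

/-- The coefficient of `s`, as a linear map. -/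
def coeffLin (s : G) : SkewMonoidAlgebra A G →ₗ[k] A where
  toFun b := b.coeff s
  map_add' _ _ := by simp
  map_smul' _ _ := by simp

/-- The sequence of elements `g_i⁻¹ x_i g_{i+1}` of `A[G]`. -/
def homSeq (g : ℕ → G) (x : ℕ → A) (i : ℕ) : SkewMonoidAlgebra A G :=
  SkewMonoidAlgebra.single ((g i)⁻¹ * g (i + 1)) ((g i)⁻¹ • x i)

/-- The homogeneous coordinates of a cochain `φ` of `A[G]`: for each sequence `g₀, …, g_n` in `G`,
the cochain of `A` which sends `x₁, …, x_n` to the coefficient of `1` in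
`g₀ φ(g₀⁻¹ x₁ g₁, g₁⁻¹ x₂ g₂, …, g_{n-1}⁻¹ x_n g_n) g_n⁻¹`. The sequence `g` is infinite for
convenience; only the entries up to `n` matter. -/
def homFamily (n : ℕ) (g : ℕ → G) :
    HochschildCochain k (SkewMonoidAlgebra A G) n →ₗ[k] HochschildCochain k A n where
  toFun φ := ((actLin k (g 0)).comp (coeffLin k ((g 0)⁻¹ * g n))).compMultilinearMap
    (φ.compLinearMap fun i => (SkewMonoidAlgebra.lsingle (R := k) ((g i)⁻¹ * g (i + 1))).comp
      (actLin k (g i)⁻¹))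
  map_add' φ ψ := by ext a; simp
  map_smul' c φ := by ext a; simp

variable {k}

theorem ev_homFamily {n : ℕ} (g : ℕ → G) (φ : HochschildCochain k (SkewMonoidAlgebra A G) n)
    (x : ℕ → A) :
    (homFamily k n g φ).ev x = g 0 • (φ.ev (homSeq g x)).coeff ((g 0)⁻¹ * g n) := rfl

theorem homFamily_congr {n : ℕ} {g g' : ℕ → G} (h : ∀ i ≤ n, g i = g' i)
    (φ : HochschildCochain k (SkewMonoidAlgebra A G) n) :
    homFamily k n g φ = homFamily k n g' φ := by
  refine ext_ev fun x => ?_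
  rw [ev_homFamily, ev_homFamily, h 0 (Nat.zero_le _), h n le_rfl]
  have hev : φ.ev (homSeq g x) = φ.ev (homSeq g' x) := ev_congr φ fun i hi => by
    rw [homSeq, homSeq, h i hi.le, h (i + 1) hi]
  rw [hev]

theorem homSeq_smul (s : G) (g : ℕ → G) (x : ℕ → A) :
    homSeq (fun i => s * g i) (fun i => s • x i) = homSeq g x := by
  funext i
  simp only [homSeq, mul_inv_rev, mul_assoc, inv_mul_cancel_left, mul_smul, inv_smul_smul]

/-- The homogeneous coordinates form a `G`-equivariant family. -/
theorem ev_homFamily_smul {n : ℕ} (s : G) (g : ℕ → G)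
    (φ : HochschildCochain k (SkewMonoidAlgebra A G) n) (x : ℕ → A) :
    (homFamily k n (fun i => s * g i) φ).ev (fun i => s • x i) =
      s • (homFamily k n g φ).ev x := by
  rw [ev_homFamily, ev_homFamily, homSeq_smul]
  simp only [mul_inv_rev, mul_assoc, inv_mul_cancel_left, mul_smul]

theorem contr_homSeq (j : ℕ) (g : ℕ → G) (x : ℕ → A) :
    contr j (homSeq g x) = homSeq (skip (j + 1) g) (contr j x) := by
  funext l
  rcases lt_trichotomy l j with h | rfl | h
  · simp [contr, homSeq, skip, h, (by omega : l < j + 1)]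
  · simp [contr, homSeq, skip, SkewMonoidAlgebra.single_mul_single, mul_assoc, mul_smul]
  · simp only [contr, homSeq, skip, if_neg (by omega : ¬ l < j), if_neg (by omega : ¬ l < j + 1),
      if_neg (by omega : ¬ l = j), if_neg (by omega : ¬ l + 1 < j + 1)]

/-- In homogeneous coordinates, the Hochschild coboundary is the alternating sum of the faces. -/
theorem ev_homFamily_d {n : ℕ} (φ : HochschildCochain k (SkewMonoidAlgebra A G) n) (g : ℕ → G)
    (x : ℕ → A) :
    (homFamily k (n + 1) g (d n φ)).ev x = ∑ j ∈ Finset.range (n + 2),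
      (-1 : k) ^ j • face n (fun g x => (homFamily k n g φ).ev x) j g x := by
  have hfirst : g 0 • (homSeq g x 0 * φ.ev (fun i => homSeq g x (i + 1))).coeff
      ((g 0)⁻¹ * g (n + 1)) = face n (fun g x => (homFamily k n g φ).ev x) 0 g x := by
    rw [face_zero, ev_homFamily, homSeq, SkewMonoidAlgebra.coeff_single_mul, smul_mul',
      smul_inv_smul, smul_smul]
    simp only [zero_add, mul_inv_rev, inv_inv, mul_assoc, mul_inv_cancel_left]
    rfl
  have hlast : g 0 • (φ.ev (homSeq g x) * homSeq g x n).coeff ((g 0)⁻¹ * g (n + 1)) =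
      face n (fun g x => (homFamily k n g φ).ev x) (n + 1) g x := by
    rw [face_last, ev_homFamily, homSeq, SkewMonoidAlgebra.coeff_mul_single, smul_mul',
      smul_smul, smul_smul]
    simp [mul_assoc]
  have hmid : ∀ j ∈ Finset.range n, (-1 : k) ^ (j + 1) •
      g 0 • (φ.ev (contr j (homSeq g x))).coeff ((g 0)⁻¹ * g (n + 1)) =
      (-1 : k) ^ (j + 1) • face n (fun g x => (homFamily k n g φ).ev x) (j + 1) g x := by
    intro j hj
    rw [Finset.mem_range] at hj
    rw [face_succ hj, ev_homFamily, contr_homSeq, skip, skip, if_pos (Nat.succ_pos j),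
      if_neg (by omega)]
  have hlin : ∀ b : SkewMonoidAlgebra A G, g 0 • b.coeff ((g 0)⁻¹ * g (n + 1)) =
    ((actLin k (g 0)).comp (coeffLin k ((g 0)⁻¹ * g (n + 1)))) b := fun _ => rfl
  rw [Finset.sum_range_succ, Finset.sum_range_succ', pow_zero, one_smul,
    ← Finset.sum_congr rfl hmid, ← hfirst, ← hlast, ev_homFamily, ev_d]
  simp only [hlin, map_add, map_sum, map_smul]
  abel

/-- The restriction of cochains of `A[G]` to cochains of `A`, by taking the coefficient of `1`. -/
abbrev restrictCochain (n : ℕ) :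
    HochschildCochain k (SkewMonoidAlgebra A G) n →ₗ[k] HochschildCochain k A n :=
  homFamily k n fun _ => 1

theorem homFamily_const {n : ℕ} (t : G) (φ : HochschildCochain k (SkewMonoidAlgebra A G) n) :
    homFamily k n (fun _ => t) φ =
      conj (MulSemiringAction.toAlgEquiv k A t) n (homFamily k n (fun _ => 1) φ) := by
  refine ext_ev fun x => ?_
  rw [ev_conj]
  refine Eq.trans ?_ (ev_homFamily_smul t (fun _ => 1) φ _)
  simp only [mul_one]
  congr 1
  exact funext fun i => (smul_inv_smul t (x i)).symm

theorem restrictCochain_d {n : ℕ} (φ : HochschildCochain k (SkewMonoidAlgebra A G) n) :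
    restrictCochain (n + 1) (d n φ) = d n (restrictCochain n φ) := by
  refine ext_ev fun x => ?_
  rw [ev_homFamily_d, ← sum_face_const (restrictCochain n φ) (fun _ => (1 : G))]
  refine Finset.sum_congr rfl fun j _ => ?_
  have hskip : skip j (fun _ => (1 : G)) = fun _ => 1 := funext fun l => ite_self 1
  simp only [face, hskip]

/-! ### Extension of a family of cochains to the skew group algebra -/

/-- The partial products `1, s₀, s₀ s₁, …` of a finite sequence. -/
def partialProducts {n : ℕ} (s : Fin n → G) (i : ℕ) : G := ((List.ofFn s).take i).prod

theorem partialProducts_zero {n : ℕ} (s : Fin n → G) : partialProducts s 0 = 1 := rfl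

theorem partialProducts_succ {n : ℕ} (s : Fin n → G) (i : Fin n) :
    partialProducts s (i + 1) = partialProducts s i * s i := by
  rw [partialProducts, List.prod_take_succ _ _ (by simp)]
  simp [partialProducts]

theorem partialProducts_self {n : ℕ} (s : Fin n → G) :
    partialProducts s n = (List.ofFn s).prod := by
  rw [partialProducts, List.take_of_length_le (by simp)]

theorem partialProducts_inv_mul {n : ℕ} (g : ℕ → G) {i : ℕ} (hi : i ≤ n) :
    partialProducts (fun i : Fin n => (g i)⁻¹ * g (i + 1)) i = (g 0)⁻¹ * g i := by
  induction i with
  | zero => rw [partialProducts_zero, inv_mul_cancel]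
  | succ i ih =>
    rw [partialProducts_succ _ ⟨i, hi⟩, ih (by omega), mul_assoc, mul_inv_cancel_left]

/-- A cochain in the trivial conjugacy class component, on a tuple of homogeneous elements, is
determined by its homogeneous coordinates at the sequence of partial products. -/
theorem apply_single {n : ℕ} {φ : HochschildCochain k (SkewMonoidAlgebra A G) n}
    (hφ : φ ∈ GroupGrading.classCochains (component k A) (1 : ConjClasses G) n)
    (s : Fin n → G) (a : Fin n → A) :
    φ (fun i => SkewMonoidAlgebra.single (s i) (a i)) =
      SkewMonoidAlgebra.single (List.ofFn s).prod
        (homFamily k n (partialProducts s) φ fun i => partialProducts s i • a i) := by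
  obtain ⟨c, hc⟩ := (GroupGrading.mem_classCochains_one _).1 hφ s
    (fun i => SkewMonoidAlgebra.single (s i) (a i)) fun i => ⟨a i, rfl⟩
  rw [← hc, SkewMonoidAlgebra.lsingle_apply]
  congr 1
  change _ = partialProducts s 0 • (φ fun i => SkewMonoidAlgebra.single
    ((partialProducts s i)⁻¹ * partialProducts s (i + 1))
    ((partialProducts s i)⁻¹ • partialProducts s i • a i)).coeff
      ((partialProducts s 0)⁻¹ * partialProducts s n)
  simp only [partialProducts_succ, partialProducts_self, inv_mul_cancel_left, inv_smul_smul]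
  rw [partialProducts_zero, one_smul, inv_one, one_mul, ← hc, SkewMonoidAlgebra.lsingle_apply,
    SkewMonoidAlgebra.coeff_single, Finsupp.single_eq_same]

omit [Group G] [MulSemiringAction G A] [SMulCommClass G k A] in
theorem component_eq_single {s : G} {b : SkewMonoidAlgebra A G} (hb : b ∈ component k A s) :
    b = SkewMonoidAlgebra.single s (b.coeff s) := by
  obtain ⟨a, rfl⟩ := hb
  rw [SkewMonoidAlgebra.lsingle_apply, SkewMonoidAlgebra.coeff_single, Finsupp.single_eq_same]

variable [Fintype G]

/-- Cochains of `A[G]` are equal if they agree on tuples of homogeneous elements. -/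
theorem ext_single {n : ℕ} {φ ψ : HochschildCochain k (SkewMonoidAlgebra A G) n}
    (h : ∀ (s : Fin n → G) (a : Fin n → A), φ (fun i => SkewMonoidAlgebra.single (s i) (a i)) =
      ψ fun i => SkewMonoidAlgebra.single (s i) (a i)) : φ = ψ := by
  have hsum : ∀ b : SkewMonoidAlgebra A G,
      ∑ s : G, SkewMonoidAlgebra.single s (b.coeff s) = b := fun b => by
    rw [← Finsupp.sum_fintype b.coeff SkewMonoidAlgebra.single (by simp)]
    exact b.sum_single
  refine MultilinearMap.ext fun b => ?_
  rw [show b = fun i => ∑ s : G, SkewMonoidAlgebra.single s ((b i).coeff s) from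
    funext fun i => (hsum (b i)).symm, MultilinearMap.map_sum, MultilinearMap.map_sum]
  exact Finset.sum_congr rfl fun s _ => h s _

/-- The homogeneous coordinates determine a cochain of the trivial conjugacy class. -/
theorem ext_homFamily {n : ℕ} {φ ψ : HochschildCochain k (SkewMonoidAlgebra A G) n}
    (hφ : φ ∈ GroupGrading.classCochains (component k A) (1 : ConjClasses G) n)
    (hψ : ψ ∈ GroupGrading.classCochains (component k A) (1 : ConjClasses G) n)
    (h : ∀ g, homFamily k n g φ = homFamily k n g ψ) : φ = ψ :=
  ext_single fun s a => by rw [apply_single hφ, apply_single hψ, h]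

/-- The cochain of `A[G]` which sends `a₁ s₁, …, a_n s_n` to
`F(1, s₁, s₁ s₂, …)(a₁, s₁ a₂, s₁ s₂ a₃, …) s₁ ⋯ s_n`. If `F` is `G`-equivariant, this is the
cochain with homogeneous coordinates `F`. -/
def ofFamily {n : ℕ} (F : (ℕ → G) → HochschildCochain k A n) :
    HochschildCochain k (SkewMonoidAlgebra A G) n :=
  ∑ s : Fin n → G, (SkewMonoidAlgebra.lsingle (R := k) (List.ofFn s).prod).compMultilinearMap
    ((F (partialProducts s)).compLinearMap fun i =>
      (actLin k (partialProducts s i)).comp (coeffLin k (s i)))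

theorem ofFamily_single {n : ℕ} (F : (ℕ → G) → HochschildCochain k A n) (s : Fin n → G)
    (a : Fin n → A) :
    ofFamily F (fun i => SkewMonoidAlgebra.single (s i) (a i)) =
      SkewMonoidAlgebra.single (List.ofFn s).prod
        (F (partialProducts s) fun i => partialProducts s i • a i) := by
  classical
  have hterm : ∀ t : Fin n → G,
      (SkewMonoidAlgebra.lsingle (R := k) (List.ofFn t).prod).compMultilinearMap
        ((F (partialProducts t)).compLinearMap fun i =>
          (actLin k (partialProducts t i)).comp (coeffLin k (t i)))
        (fun i => SkewMonoidAlgebra.single (s i) (a i)) =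
      SkewMonoidAlgebra.single (List.ofFn t).prod (F (partialProducts t) fun i =>
        partialProducts t i • (SkewMonoidAlgebra.single (s i) (a i)).coeff (t i)) := fun _ => rfl
  rw [ofFamily, sum_apply, Finset.sum_congr rfl fun t _ => hterm t,
    Finset.sum_eq_single s]
  · simp only [SkewMonoidAlgebra.coeff_single, Finsupp.single_eq_same]
  · intro t _ hts
    obtain ⟨i, hi⟩ := Function.ne_iff.1 hts
    rw [MultilinearMap.map_coord_zero _ i, SkewMonoidAlgebra.single_zero]
    rw [SkewMonoidAlgebra.coeff_single, Finsupp.single_eq_of_ne hi, smul_zero]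
  · simp

theorem ofFamily_mem {n : ℕ} (F : (ℕ → G) → HochschildCochain k A n) :
    ofFamily F ∈ GroupGrading.classCochains (component k A) (1 : ConjClasses G) n := by
  rw [GroupGrading.mem_classCochains_one]
  intro s b hb
  rw [show b = fun i => SkewMonoidAlgebra.single (s i) ((b i).coeff (s i)) from
    funext fun i => component_eq_single (hb i), ofFamily_single]
  exact ⟨_, rfl⟩

theorem homFamily_ofFamily {n : ℕ} {F : (ℕ → G) → HochschildCochain k A n}
    (hloc : ∀ g g' : ℕ → G, (∀ i ≤ n, g i = g' i) → F g = F g')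
    (hequiv : ∀ (s : G) (g : ℕ → G) (x : ℕ → A),
      (F fun i => s * g i).ev (fun i => s • x i) = s • (F g).ev x) (g : ℕ → G) :
    homFamily k n g (ofFamily F) = F g := by
  refine ext_ev fun x => ?_
  have hF : F (partialProducts fun i : Fin n => (g i)⁻¹ * g (i + 1)) =
      F fun i => (g 0)⁻¹ * g i :=
    hloc _ _ fun i hi => partialProducts_inv_mul g hi
  have hev : (ofFamily F).ev (homSeq g x) =
      SkewMonoidAlgebra.single ((g 0)⁻¹ * g n) ((F fun i => (g 0)⁻¹ * g i).ev
        fun i => (g 0)⁻¹ • x i) := by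
    refine (ofFamily_single F (fun i : Fin n => (g i)⁻¹ * g (i + 1))
      fun i => (g i)⁻¹ • x i).trans ?_
    rw [← partialProducts_self, partialProducts_inv_mul g le_rfl, hF]
    congr 1
    refine congrArg _ (funext fun i => ?_)
    rw [partialProducts_inv_mul g i.2.le, mul_smul, smul_inv_smul]
  rw [ev_homFamily, hev, hequiv, SkewMonoidAlgebra.coeff_single, Finsupp.single_eq_same,
    smul_inv_smul]

/-! ### Extension of invariant cochains and the averaged homotopy -/

/-- The extension to `A[G]` of an invariant cochain of `A`. -/
abbrev extendCochain {n : ℕ} (φ : HochschildCochain k A n) :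
    HochschildCochain k (SkewMonoidAlgebra A G) n :=
  ofFamily fun _ => φ

theorem homFamily_extendCochain {n : ℕ} {φ : HochschildCochain k A n} (hφ : IsInvariant G φ)
    (g : ℕ → G) : homFamily k n g (extendCochain φ) = φ :=
  homFamily_ofFamily (fun _ _ _ => rfl) (fun s _ x => hφ.ev_smul s x) g

theorem extendCochain_d {n : ℕ} {φ : HochschildCochain k A n} (hφ : IsInvariant G φ) :
    (extendCochain (d n φ) : HochschildCochain k (SkewMonoidAlgebra A G) (n + 1)) =
      d n (extendCochain φ) := by
  have hmem : extendCochain φ ∈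
      (GroupGrading.trivialClassCochains (component k A (G := G))).carrier n := ofFamily_mem _
  have hmem' := (GroupGrading.trivialClassCochains (component k A (G := G))).d_mem hmem
  refine ext_homFamily (ofFamily_mem _) hmem' fun g => ?_
  have h : ∀ g x, (homFamily k n g (extendCochain φ)).ev x = φ.ev x := fun g x => by
    rw [homFamily_extendCochain hφ]
  refine ext_ev fun x => ?_
  rw [homFamily_extendCochain hφ.d, ev_homFamily_d, ← sum_face_const φ g]
  simp only [h]

/-- The family
`(g₀, …, g_n) ↦ |G|⁻¹ ∑_{t, i} (-1)^i F(g₀, …, g_i, t, …, t)(…, x_i, 1, x_{i+1}, …)`,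
where `F` are the homogeneous coordinates of `φ`. If `φ` is a cocycle, the
coboundary of this family compares `φ` with the extension of its averaged restriction. -/
def homotopyFamily {n : ℕ} (φ : HochschildCochain k (SkewMonoidAlgebra A G) (n + 1))
    (g : ℕ → G) : HochschildCochain k A n :=
  (Fintype.card G : k)⁻¹ • ∑ t : G, ∑ i : Fin (n + 1),
    (-1 : k) ^ (i : ℕ) • insertOne i (homFamily k (n + 1) (fillSeq t i g) φ)

theorem ev_homotopyFamily {n : ℕ} (φ : HochschildCochain k (SkewMonoidAlgebra A G) (n + 1))
    (g : ℕ → G) (x : ℕ → A) :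
    (homotopyFamily φ g).ev x = (Fintype.card G : k)⁻¹ • ∑ t : G, ∑ i ∈ Finset.range (n + 1),
      (-1 : k) ^ i • degenerate (fun g x => (homFamily k (n + 1) g φ).ev x) t i g x := by
  rw [homotopyFamily, ev_smul, ev_sum]
  congr 1
  refine Finset.sum_congr rfl fun t _ => ?_
  rw [ev_sum, Finset.sum_range]
  exact Finset.sum_congr rfl fun i _ => by rw [ev_smul, ev_insertOne]; rfl

theorem homFamily_ofFamily_homotopyFamily {n : ℕ}
    (φ : HochschildCochain k (SkewMonoidAlgebra A G) (n + 1)) (g : ℕ → G) :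
    homFamily k n g (ofFamily (homotopyFamily φ)) = homotopyFamily φ g := by
  refine homFamily_ofFamily (fun g g' h => ?_) (fun s g x => ?_) g
  · rw [homotopyFamily, homotopyFamily]
    congr 1
    refine Finset.sum_congr rfl fun t _ => Finset.sum_congr rfl fun i _ => ?_
    congr 2
    refine homFamily_congr (fun l _ => ?_) φ
    simp only [fillSeq]
    split_ifs
    · exact h l (by omega)
    · rfl
  · rw [ev_homotopyFamily, ev_homotopyFamily, smul_comm s (_ : k)]
    congr 1
    rw [Finset.smul_sum, ← Equiv.sum_comp (Equiv.mulLeft s)]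
    refine Finset.sum_congr rfl fun t _ => ?_
    rw [Finset.smul_sum]
    refine Finset.sum_congr rfl fun i _ => ?_
    rw [smul_comm s (_ : k), degenerate, degenerate, ← ev_homFamily_smul]
    have hg : fillSeq (Equiv.mulLeft s t) i (fun i => s * g i) = fun l => s * fillSeq t i g l := by
      funext l
      simp only [fillSeq, Equiv.coe_mulLeft]
      split_ifs <;> rfl
    have hx : insertOneSeq i (fun i => s • x i) = fun l => s • insertOneSeq i x l := by
      funext l
      simp only [insertOneSeq]
      split_ifs <;> simp
    rw [hg, hx]

/-- A cocycle of the trivial conjugacy class is cohomologous to the extension of the average of its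
restriction to `A`. -/
theorem sub_extendCochain_mem_coboundaries (hG : (Fintype.card G : k) ≠ 0) {n : ℕ}
    {φ : HochschildCochain k (SkewMonoidAlgebra A G) n}
    (hφ : φ ∈ (GroupGrading.trivialClassCochains (component k A (G := G))).cocycles n) :
    φ - extendCochain (avg k A G n (restrictCochain n φ)) ∈
      (GroupGrading.trivialClassCochains (component k A (G := G))).coboundaries n := by
  have hmem : φ - extendCochain (avg k A G n (restrictCochain n φ)) ∈
      GroupGrading.classCochains (component k A) (1 : ConjClasses G) n :=
    Submodule.sub_mem _ hφ.1 (ofFamily_mem _)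
  have hd : ∀ g x, ∑ j ∈ Finset.range (n + 2), (-1 : k) ^ j •
      face n (fun g x => (homFamily k n g φ).ev x) j g x = 0 := fun g x => by
    rw [← ev_homFamily_d, show d n φ = 0 from hφ.2, map_zero]
    rfl
  -- As `φ` is a cocycle, only the terms `∂ h` of `∂ h + h ∂` survive.
  have hhom : ∀ t g x, ∑ j ∈ Finset.range (n + 1), ∑ i ∈ Finset.range n, (-1 : k) ^ (i + j) •
      face (n - 1) (fun g x => degenerate (fun g x => (homFamily k n g φ).ev x) t i g x) j g x =
      (homFamily k n (fun _ => t) φ).ev x - (homFamily k n g φ).ev x := fun t g x => by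
    rw [← sum_face_degenerate (k := k) (n := n) (F := fun g x => (homFamily k n g φ).ev x)
      (fun g g' x x' hg hx => by rw [homFamily_congr hg]; exact ev_congr _ hx) t g x]
    refine ((congrArg (· + _) (Finset.sum_eq_zero fun i _ => ?_)).trans (zero_add _)).symm
    simp only [pow_add, mul_smul, ← Finset.smul_sum, hd, smul_zero]
  have havg : ∀ g x, (homFamily k n g
      (φ - extendCochain (avg k A G n (restrictCochain n φ)))).ev x =
      -((Fintype.card G : k)⁻¹ • ∑ t : G,
        ((homFamily k n (fun _ => t) φ).ev x - (homFamily k n g φ).ev x)) := fun g x => by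
    rw [map_sub, homFamily_extendCochain (isInvariant_avg G _), ev_sub, avg_apply, ev_smul, ev_sum]
    simp only [← homFamily_const, Finset.sum_sub_distrib, Finset.sum_const, Finset.card_univ,
      smul_sub, ← Nat.cast_smul_eq_nsmul k, inv_smul_smul₀ hG]
    abel
  cases n with
  | zero =>
    refine (Submodule.mem_bot k).2 ?_
    refine ext_homFamily hmem (Submodule.zero_mem _) fun g => ext_ev fun x => ?_
    rw [havg, map_zero]
    simp only [← hhom]
    simp [ev]
  | succ n =>
    refine ⟨-ofFamily (homotopyFamily φ), Submodule.neg_mem _ (ofFamily_mem _), ?_⟩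
    have hmem' : d n (-ofFamily (homotopyFamily φ)) ∈
        (GroupGrading.trivialClassCochains (component k A (G := G))).carrier (n + 1) :=
      (GroupGrading.trivialClassCochains (component k A (G := G))).d_mem
        (Submodule.neg_mem _ (ofFamily_mem _))
    refine ext_homFamily hmem' hmem fun g => ext_ev fun x => ?_
    have hface : ∀ j, (-1 : k) ^ j • face n
        (fun g x => (homFamily k n g (ofFamily (homotopyFamily φ))).ev x) j g x =
        (Fintype.card G : k)⁻¹ • ∑ t : G, ∑ i ∈ Finset.range (n + 1), (-1 : k) ^ (i + j) •
          face n (fun g x => degenerate (fun g x => (homFamily k (n + 1) g φ).ev x) t i g x)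
            j g x := fun j => by
      simp only [homFamily_ofFamily_homotopyFamily, ev_homotopyFamily, face_smul, face_sum]
      rw [smul_comm, Finset.smul_sum]
      simp only [Finset.smul_sum, smul_smul, ← pow_add, add_comm j]
    rw [havg, map_neg, map_neg]
    refine congrArg Neg.neg ((ev_homFamily_d _ g x).trans ?_)
    rw [ Finset.sum_congr rfl fun j _ => hface j, ← Finset.smul_sum,
      Finset.sum_comm]
    exact congrArg _ (Finset.sum_congr rfl fun t _ => hhom t g x)
end SkewGroupAlgebra

/-! ### The restriction homomorphism in cohomology -/

theorem HochschildDGSubalgebra.mem_cocycles_full {k A : Type*} [Field k] [Ring A] [Algebra k A]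
    {n : ℕ} {φ : HochschildCochain k A n} (h : d n φ = 0) : φ ∈ (full k A).cocycles n :=
  ⟨trivial, h⟩

namespace HochschildCohomology

variable {k : Type*} {A : Type*} {G : Type*} [Field k] [Ring A] [Algebra k A] [Group G]
variable [MulSemiringAction G A] [SMulCommClass G k A]

/-- Invariance of a class in `HH^*(A)` can be checked in each degree. -/
theorem mem_invariants_iff {x : HochschildCohomologyAlgebra k A} :
    x ∈ invariants k A G ↔ ∀ (s : G) (n : ℕ),
      conjCohomology (MulSemiringAction.toAlgEquiv k A s) n (x n) = x n := by
  have hcomp : ∀ (σ : A ≃ₐ[k] A) (n : ℕ) (x : HochschildCohomologyAlgebra k A),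
      conjAlgHom σ x n = conjCohomology σ n (x n) := by
    intro σ n x
    induction x using DirectSum.induction_on with
    | zero => simp
    | of m x =>
      rw [conjAlgHom_of]
      obtain rfl | h := eq_or_ne m n
      · rw [DirectSum.of_eq_same, DirectSum.of_eq_same]
      · rw [DirectSum.of_eq_of_ne _ _ _ h.symm, DirectSum.of_eq_of_ne _ _ _ h.symm, map_zero]
    | add x y hx hy => rw [map_add, DirectSum.add_apply, DirectSum.add_apply, map_add, hx, hy]
  rw [invariants, Algebra.mem_iInf]
  refine forall_congr' fun s => ?_
  rw [AlgHom.mem_equalizer]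
  change conjAlgHom _ x = x ↔ _
  rw [DFinsupp.ext_iff]
  exact forall_congr' fun n => by rw [hcomp]

end HochschildCohomology

namespace SkewGroupAlgebra

variable {k : Type*} {A : Type*} {G : Type*} [Field k] [Ring A] [Algebra k A] [Group G]
variable [MulSemiringAction G A] [SMulCommClass G k A]

theorem restrictCochain_one :
    restrictCochain 0 (one k (SkewMonoidAlgebra A G)) = one k A := by
  refine ext_ev fun x => ?_
  rw [ev_homFamily, ev_one, ev_one]
  simp

/-- Restriction is multiplicative because the first factor takes values in the component of `1` on
elements of `A`; on cochains outside the trivial conjugacy class this fails. -/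
theorem restrictCochain_cup {m n : ℕ} {ψ : HochschildCochain k (SkewMonoidAlgebra A G) m}
    (hψ : ψ ∈ GroupGrading.classCochains (component k A) (1 : ConjClasses G) m)
    (φ : HochschildCochain k (SkewMonoidAlgebra A G) n) :
    restrictCochain (m + n) (cup ψ φ) = cup (restrictCochain m ψ) (restrictCochain n φ) := by
  refine ext_ev fun x => ?_
  have hmem : ψ.ev (homSeq (fun _ => (1 : G)) x) ∈ component k A (1 : G) := by
    have h := (GroupGrading.mem_classCochains_one _).1 hψ (fun _ => (1 : G))
      (fun i => homSeq (fun _ => (1 : G)) x i) fun i =>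
        ⟨x i, by simp [homSeq, SkewMonoidAlgebra.lsingle_apply]⟩
    rwa [List.ofFn_const, List.prod_replicate, one_pow] at h
  rw [ev_cup, ev_homFamily, ev_homFamily, ev_homFamily, ev_cup, component_eq_single hmem]
  have hshift : (fun i => homSeq (fun _ => (1 : G)) x (m + i)) =
      homSeq (fun _ => (1 : G)) fun i => x (m + i) := rfl
  rw [hshift]
  simp

variable (k A G) in
/-- The restriction of cocycles of the trivial conjugacy class to `A`. -/
def restrictCocycles (n : ℕ) :
    (GroupGrading.trivialClassCochains (component k A (G := G))).cocycles n →ₗ[k]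
      (full k A).cocycles n :=
  (restrictCochain n).restrict fun φ hφ => ⟨trivial, by
    change d n (restrictCochain n φ) = 0
    rw [← restrictCochain_d, show d n φ = 0 from hφ.2, map_zero]⟩

variable (k A G) in
/-- The map induced in degree `n` cohomology by restriction of cochains to `A`. -/
def restrictCohomology (n : ℕ) :
    (GroupGrading.trivialClassCochains (component k A (G := G))).Cohomology n →ₗ[k]
      HochschildCohomology k A n :=
  Submodule.mapQ _ _ (restrictCocycles k A G n) <| by
    intro x hx
    change restrictCochain n x.1 ∈ (full k A).coboundaries n
    change x.1 ∈ (GroupGrading.trivialClassCochains (component k A (G := G))).coboundaries n at hx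
    cases n with
    | zero =>
      rw [(Submodule.mem_bot k).1 hx, map_zero]
      exact Submodule.zero_mem _
    | succ n =>
      obtain ⟨c, _, hc⟩ := hx
      rw [← hc, restrictCochain_d]
      exact ⟨restrictCochain n c, trivial, rfl⟩

theorem restrictCohomology_cls (n : ℕ)
    (x : (GroupGrading.trivialClassCochains (component k A (G := G))).cocycles n) :
    restrictCohomology k A G n (cls _ n x) = (full k A).cls n (restrictCocycles k A G n x) := rfl

variable (k A G) in
/-- The algebra homomorphism from the cohomology of the trivial conjugacy class to the Hochschild
cohomology of `A` induced by restriction of cochains. -/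
def restrictAlgHom : GroupGrading.TrivialClassCohomologyAlgebra (component k A (G := G)) →ₐ[k]
    HochschildCohomologyAlgebra k A :=
  DirectSum.toAlgebra k (GroupGrading.trivialClassCochains (component k A (G := G))).Cohomology
    (fun n => (DirectSum.lof k ℕ (HochschildCohomology k A) n).comp (restrictCohomology k A G n))
    (congrArg (DirectSum.of (HochschildCohomology k A) 0)
      (congrArg ((full k A).cls 0) (Subtype.ext restrictCochain_one)))
    (by
      intro m n x y
      obtain ⟨x, rfl⟩ := cls_surjective _ _ x
      obtain ⟨y, rfl⟩ := cls_surjective _ _ y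
      simp only [LinearMap.comp_apply, DirectSum.lof_eq_of, DirectSum.of_mul_of]
      exact congrArg (DirectSum.of (HochschildCohomology k A) (m + n))
        (congrArg ((full k A).cls (m + n)) (Subtype.ext (restrictCochain_cup x.2.1 y.1))))

theorem restrictAlgHom_of (n : ℕ)
    (x : (GroupGrading.trivialClassCochains (component k A (G := G))).Cohomology n) :
    restrictAlgHom k A G (DirectSum.of _ n x) =
      DirectSum.of (HochschildCohomology k A) n (restrictCohomology k A G n x) :=
  DirectSum.toAddMonoid_of _ _ _

theorem restrictAlgHom_apply
    (x : GroupGrading.TrivialClassCohomologyAlgebra (component k A (G := G))) (n : ℕ) :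
    restrictAlgHom k A G x n = restrictCohomology k A G n (x n) := by
  induction x using DirectSum.induction_on with
  | zero => simp
  | of m x =>
    rw [restrictAlgHom_of]
    obtain rfl | h := eq_or_ne m n
    · rw [DirectSum.of_eq_same, DirectSum.of_eq_same]
    · rw [DirectSum.of_eq_of_ne _ _ _ h.symm, DirectSum.of_eq_of_ne _ _ _ h.symm, map_zero]
  | add x y hx hy => rw [map_add, DirectSum.add_apply, DirectSum.add_apply, map_add, hx, hy]

variable [Fintype G]

/-- If the restriction of a cocycle is a coboundary, so is the extension of its average, to which
the cocycle is cohomologous. -/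
theorem restrictCohomology_injective (hG : (Fintype.card G : k) ≠ 0) (n : ℕ) :
    Function.Injective (restrictCohomology k A G n) := by
  refine (injective_iff_map_eq_zero _).2 fun x hx => ?_
  obtain ⟨x, rfl⟩ := cls_surjective _ _ x
  rw [restrictCohomology_cls, ← map_zero ((full k A).cls n), cls_eq_iff] at hx
  have hx' : restrictCochain n x.1 ∈ (full k A).coboundaries n := by
    rw [Submodule.coe_zero, sub_zero] at hx
    exact hx
  have hext : extendCochain (avg k A G n (restrictCochain n x.1)) ∈
      (GroupGrading.trivialClassCochains (component k A (G := G))).coboundaries n := by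
    cases n with
    | zero =>
      rw [(Submodule.mem_bot k).1 hx', map_zero]
      refine (Submodule.mem_bot k).2 (ext_single fun s a => ?_)
      rw [ofFamily_single]
      exact SkewMonoidAlgebra.single_zero _
    | succ n =>
      obtain ⟨c, _, hc⟩ := hx'
      rw [← hc, avg_d, extendCochain_d (isInvariant_avg G c)]
      exact ⟨_, ofFamily_mem _, rfl⟩
  rw [← map_zero (cls _ n), cls_eq_iff]
  have h := Submodule.add_mem _ (sub_extendCochain_mem_coboundaries hG x.2) hext
  rw [sub_add_cancel] at h
  simpa using h

/-- The extension to `A[G]` of an invariant cocycle of `A`. -/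
def extendCocycle {n : ℕ} {z : HochschildCochain k A n} (hz : IsInvariant G z) (hd : d n z = 0) :
    (GroupGrading.trivialClassCochains (component k A (G := G))).cocycles n :=
  ⟨extendCochain z, ofFamily_mem _, by
    change d n (extendCochain z) = 0
    rw [← extendCochain_d hz, hd]
    refine ext_single fun s a => ?_
    rw [ofFamily_single]
    exact SkewMonoidAlgebra.single_zero _⟩

theorem restrictCocycles_extendCocycle {n : ℕ} {z : HochschildCochain k A n}
    (hz : IsInvariant G z) (hd : d n z = 0) :
    restrictCocycles k A G n (extendCocycle hz hd) = ⟨z, mem_cocycles_full hd⟩ := by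
  refine Subtype.ext ?_
  change restrictCochain n (extendCochain z) = z
  exact homFamily_extendCochain hz _

/-- The range of the restriction map consists of the classes fixed by `G`. -/
theorem mem_range_restrictCohomology_iff (hG : (Fintype.card G : k) ≠ 0) {n : ℕ}
    {y : HochschildCohomology k A n} :
    (∃ x, restrictCohomology k A G n x = y) ↔ ∀ s : G,
      HochschildCohomology.conjCohomology (MulSemiringAction.toAlgEquiv k A s) n y = y := by
  constructor
  · rintro ⟨x, rfl⟩ s
    obtain ⟨x, rfl⟩ := cls_surjective _ _ x
    have hd : d n (avg k A G n (restrictCochain n x.1)) = 0 := by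
      rw [← avg_d, ← restrictCochain_d, show d n x.1 = 0 from x.2.2, map_zero, map_zero]
    have hx : cls _ n x = cls _ n (extendCocycle (isInvariant_avg G _) hd) :=
      (cls_eq_iff _).2 (sub_extendCochain_mem_coboundaries hG x.2)
    rw [hx, restrictCohomology_cls, restrictCocycles_extendCocycle,
      HochschildCohomology.conjCohomology_cls]
    exact congrArg _ (Subtype.ext (isInvariant_avg G _ s))
  · intro hy
    obtain ⟨z, rfl⟩ := (full k A).cls_surjective _ y
    have hd : d n (avg k A G n z.1) = 0 := by
      rw [← avg_d, show d n z.1 = 0 from z.2.2, map_zero]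
    refine ⟨cls _ n (extendCocycle (isInvariant_avg G _) hd), ?_⟩
    rw [restrictCohomology_cls, restrictCocycles_extendCocycle]
    have havg : (⟨avg k A G n z.1, mem_cocycles_full hd⟩ : (full k A).cocycles n) =
        (Fintype.card G : k)⁻¹ • ∑ s : G,
          HochschildCohomology.conjCocycles (MulSemiringAction.toAlgEquiv k A s) n z := by
      refine Subtype.ext ((avg_apply G z.1).trans ?_)
      rw [Submodule.coe_smul, Submodule.coe_sum]
      rfl
    rw [havg, map_smul, map_sum]
    simp only [← HochschildCohomology.conjCohomology_cls, hy, Finset.sum_const, Finset.card_univ,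
      ← Nat.cast_smul_eq_nsmul k, inv_smul_smul₀ hG]

theorem restrictAlgHom_injective (hG : (Fintype.card G : k) ≠ 0) :
    Function.Injective (restrictAlgHom k A G) := fun x y h =>
  DFinsupp.ext fun n => restrictCohomology_injective hG n <| by
    rw [← restrictAlgHom_apply, ← restrictAlgHom_apply, h]

theorem range_restrictAlgHom (hG : (Fintype.card G : k) ≠ 0) :
    (restrictAlgHom k A G).range = HochschildCohomology.invariants k A G := by
  classical
  refine SetLike.ext fun y => ?_
  rw [HochschildCohomology.mem_invariants_iff, forall_comm]
  simp only [← mem_range_restrictCohomology_iff hG]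
  constructor
  · rintro ⟨x, rfl⟩ n
    exact ⟨x n, (restrictAlgHom_apply x n).symm⟩
  · intro h
    choose x hx using h
    rw [← DirectSum.sum_support_of y]
    refine Subalgebra.sum_mem _ fun n _ => ⟨DirectSum.of _ n (x n), ?_⟩
    exact (restrictAlgHom_of n (x n)).trans (congrArg _ (hx n))

end SkewGroupAlgebra

end

theorem mainTheorem2 (k : Type*) [Field k] (G : Type*) [Group G] [Finite G]
    (hG : IsUnit (Nat.card G : k)) (Λ : Type*) [Ring Λ] [Algebra k Λ]
    [MulSemiringAction G Λ] [SMulCommClass G k Λ] :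
    ∃ e : GroupGrading.TrivialClassCohomologyAlgebra (SkewGroupAlgebra.component k Λ (G := G)) ≃ₐ[k]
        HochschildCohomology.invariants k Λ G,
      ∀ (n : ℕ) (x : (GroupGrading.trivialClassCochains
          (SkewGroupAlgebra.component k Λ (G := G))).Cohomology n),
        ∃ y : HochschildCohomology k Λ n,
          (e (DirectSum.of _ n x) : HochschildCohomologyAlgebra k Λ) = DirectSum.of _ n y := by
  have := Fintype.ofFinite G
  have hcard : (Fintype.card G : k) ≠ 0 := by
    rw [← Nat.card_eq_fintype_card]
    exact hG.ne_zero
  exact ⟨(AlgEquiv.ofInjective _ (SkewGroupAlgebra.restrictAlgHom_injective hcard)).trans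
      (Subalgebra.equivOfEq _ _ (SkewGroupAlgebra.range_restrictAlgHom hcard)),
    fun n x => ⟨SkewGroupAlgebra.restrictCohomology k Λ G n x,
      SkewGroupAlgebra.restrictAlgHom_of n x⟩⟩
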